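/- Let $f\in\mathbb R[x,y]$ be a non-zero polynomial, let $\mathbb RV=\{(x,y)\in(\mathbb R^*)^2 : f(x,y)=0\}$ be the real algebraic curve that it defines, and let $\operatorname{Log}:\mathbb RV\to\mathbb R^2$, $\operatorname{Log}(x,y)=(\log|x|,\log|y|)$; this map is proper. Let $R$ be any commutative ring of coefficients (for example $\mathbb Z$ or $\mathbb Z/2$), and let $H^c_*(\,\cdot\,;R)$ denote homology with closed supports, i.e. the homology of the complex of locally finite singular chains (possibly infinite $R$-linear combinations of singular simplices such that each compact set meets only finitely many of them). It is covariant for proper maps. 1. If $\mathbb RV$ is non-singular (the gradient of $f$ vanishes at no point of $\mathbb RV$), then $\mathbb RV$ carries a fundamental class $[\mathbb RV]\in H^c_1(\mathbb RV;R)$, i.e. a class whose restriction generates the $R$-module $H_1(\mathbb RV,\mathbb RV\setminus\{p\};R)$ for every $p\in\mathbb RV$. 2. The logarithmic image of $\mathbb RV$ (singular or not) is trivial in $H^c_1(\mathbb R^2;R)$: $\operatorname{Log}_*\mu=0$ for every class $\mu\in H^c_1(\mathbb RV;R)$, in particular for every fundamental class $\mu=[\mathbb RV]$. 3. Hence it bounds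 a region in the plane (counted with multiplicities): for every locally finite $1$-cycle $c$ of $\mathbb RV$ there is a locally finite singular $2$-chain $b$ of $\mathbb R^2$ with $\partial b=\operatorname{Log}_\#c$. -/

import Mathlib

noncomputable section

/-! ### Homology with closed supports (locally finite singular homology) -/

namespace ClosedSupport

/-- Singular `n`-simplices of `X`. -/
abbrev Simplex (n : ℕ) (X : Type*) [TopologicalSpace X] : Type _ :=
  C(stdSimplex ℝ (Fin (n + 1)), X)

/-- The `i`-th face of a singular simplex. -/
def face {n : ℕ} {X : Type*} [TopologicalSpace X] (i : Fin (n + 2)) (σ : Simplex (n + 1) X) :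
    Simplex n X :=
  σ.comp ⟨stdSimplex.map (Fin.succAbove i), stdSimplex.continuous_map _⟩

/-- Closed-support singular `n`-chains: possibly infinite formal `R`-linear combinations of
singular simplices such that every compact set meets only finitely many of the simplices that
occur. -/
def chainSubmodule (R : Type*) [CommRing R] (n : ℕ) (X : Type*) [TopologicalSpace X] :
    Submodule R (Simplex n X → R) where
  carrier := {c | ∀ K : Set X, IsCompact K →
    {σ : Simplex n X | c σ ≠ 0 ∧ (Set.range σ ∩ K).Nonempty}.Finite}
  zero_mem' := by
    intro K _
    simp
  add_mem' := by
    intro a b ha hb K hK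
    refine ((ha K hK).union (hb K hK)).subset ?_
    rintro σ ⟨h, hσ⟩
    by_cases h0 : a σ = 0
    · right
      refine ⟨fun h1 => h ?_, hσ⟩
      simp [h0, h1]
    · left
      exact ⟨h0, hσ⟩
  smul_mem' := by
    intro r a ha K hK
    refine (ha K hK).subset ?_
    rintro σ ⟨h, hσ⟩
    refine ⟨fun h1 => h ?_, hσ⟩
    simp [h1]

/-- The `R`-module of closed-support singular `n`-chains; `c.1 σ` is the coefficient of `σ`. -/
def Chain (R : Type*) [CommRing R] (n : ℕ) (X : Type*) [TopologicalSpace X] : Type _ :=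
  chainSubmodule R n X

instance (R : Type*) [CommRing R] (n : ℕ) (X : Type*) [TopologicalSpace X] :
    AddCommGroup (Chain R n X) :=
  inferInstanceAs (AddCommGroup (chainSubmodule R n X))

instance (R : Type*) [CommRing R] (n : ℕ) (X : Type*) [TopologicalSpace X] :
    Module R (Chain R n X) :=
  inferInstanceAs (Module R (chainSubmodule R n X))

theorem Chain.ext {R : Type*} [CommRing R] {n : ℕ} {X : Type*} [TopologicalSpace X]
    {a b : Chain R n X} (h : ∀ σ, a.1 σ = b.1 σ) : a = b :=
  Subtype.ext (funext h)

/-- A map `g` from simplices of `X` to simplices of `Y` is admissible if the simplices whose image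
under `g` meets a given compact set all meet one compact set. -/
def Admissible {m n : ℕ} {X Y : Type*} [TopologicalSpace X] [TopologicalSpace Y]
    (g : Simplex m X → Simplex n Y) : Prop :=
  ∀ K : Set Y, IsCompact K → ∃ L : Set X, IsCompact L ∧
    ∀ σ, (Set.range (g σ) ∩ K).Nonempty → (Set.range σ ∩ L).Nonempty

section push

variable {R : Type*} [CommRing R] {m n : ℕ} {X Y : Type*} [TopologicalSpace X]
  [TopologicalSpace Y]

theorem Admissible.finite_fiber {g : Simplex m X → Simplex n Y} (hg : Admissible g)
    (c : Chain R m X) (τ : Simplex n Y) : {σ | g σ = τ ∧ c.1 σ ≠ 0}.Finite := by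
  obtain ⟨L, hL, h⟩ := hg (Set.range τ) (isCompact_range τ.continuous)
  refine (c.2 L hL).subset ?_
  rintro σ ⟨rfl, hσ⟩
  exact ⟨hσ, h σ (by simpa using Set.range_nonempty (g σ))⟩

/-- The linear extension `∑ c_σ σ ↦ ∑ c_σ g(σ)` of an admissible map of simplices to closed-support
chains; the coefficient of `τ` is the (finite) sum of the `c_σ` over all `σ` with `g σ = τ`. -/
def push (g : Simplex m X → Simplex n Y) (hg : Admissible g) : Chain R m X →ₗ[R] Chain R n Y where
  toFun c := ⟨fun τ => ∑ᶠ σ ∈ {σ | g σ = τ}, c.1 σ, by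
    intro K hK
    obtain ⟨L, hL, h⟩ := hg K hK
    refine ((c.2 L hL).image g).subset ?_
    rintro τ ⟨h0, hτ⟩
    obtain ⟨σ, hσ, h1⟩ := exists_ne_zero_of_finsum_mem_ne_zero h0
    have h2 : g σ = τ := hσ
    subst h2
    exact ⟨σ, ⟨h1, h σ hτ⟩, rfl⟩⟩
  map_add' a b := by
    refine Chain.ext fun τ => ?_
    exact finsum_mem_add_distrib' (hg.finite_fiber a τ) (hg.finite_fiber b τ)
  map_smul' r a := by
    refine Chain.ext fun τ => ?_
    exact ((DistribSMul.toAddMonoidHom R r).map_finsum_mem' (hg.finite_fiber a τ)).symm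

theorem push_apply (g : Simplex m X → Simplex n Y) (hg : Admissible g) (c : Chain R m X)
    (τ : Simplex n Y) : (push g hg c).1 τ = ∑ᶠ σ ∈ {σ | g σ = τ}, c.1 σ := rfl

end push

theorem push_push {R : Type*} [CommRing R] {l m n : ℕ} {X Y Z : Type*} [TopologicalSpace X]
    [TopologicalSpace Y] [TopologicalSpace Z] (g : Simplex l X → Simplex m Y) (hg : Admissible g)
    (h : Simplex m Y → Simplex n Z) (hh : Admissible h) (k : Simplex l X → Simplex n Z)
    (hk : Admissible k) (e : ∀ σ, h (g σ) = k σ) (c : Chain R l X) :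
    push h hh (push g hg c) = push k hk c := by
  refine Chain.ext fun τ => ?_
  have hfin := hk.finite_fiber c τ
  simp only [push_apply]
  rw [finsum_mem_eq_sum_of_inter_support_eq (t := hfin.toFinset) _
    (by ext σ; simp [Function.mem_support])]
  classical
  have e1 : ∀ ρ : Simplex m Y, h ρ = τ → ∑ᶠ σ ∈ {σ | g σ = ρ}, c.1 σ
      = ∑ σ ∈ hfin.toFinset with g σ = ρ, c.1 σ := by
    intro ρ hρ
    refine finsum_mem_eq_sum_of_inter_support_eq _ ?_
    ext σ
    simp only [Set.mem_inter_iff, Set.mem_ofPred_eq, Function.mem_support, Finset.coe_filter,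
      Set.Finite.mem_toFinset]
    constructor
    · rintro ⟨rfl, h2⟩
      exact ⟨⟨⟨(e σ).symm.trans hρ, h2⟩, rfl⟩, h2⟩
    · rintro ⟨⟨_, h1⟩, h2⟩
      exact ⟨h1, h2⟩
  rw [finsum_mem_congr (s := {ρ | h ρ = τ}) rfl (fun ρ hρ => e1 ρ hρ)]
  rw [finsum_mem_eq_sum_of_inter_support_eq (t := hfin.toFinset.image g)]
  · refine Finset.sum_fiberwise_of_maps_to (fun σ hσ => ?_) _
    exact Finset.mem_image_of_mem g hσ
  · ext ρ
    simp only [Set.mem_inter_iff, Set.mem_ofPred_eq, Function.mem_support, Finset.coe_image,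
      Set.mem_image]
    constructor
    · rintro ⟨_, h2⟩
      refine ⟨?_, h2⟩
      obtain ⟨σ, hσ, _⟩ := Finset.exists_ne_zero_of_sum_ne_zero h2
      simp only [Finset.mem_filter] at hσ
      exact ⟨σ, hσ.1, hσ.2⟩
    · rintro ⟨⟨σ, hσ, rfl⟩, h2⟩
      have h3 : k σ = τ ∧ c.1 σ ≠ 0 := by simpa using hσ
      exact ⟨(e σ).trans h3.1, h2⟩

theorem face_admissible {n : ℕ} {X : Type*} [TopologicalSpace X] (i : Fin (n + 2)) :
    Admissible (face (X := X) i) := by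
  intro K hK
  refine ⟨K, hK, ?_⟩
  rintro σ ⟨_, ⟨t, rfl⟩, ht⟩
  exact ⟨_, ⟨_, rfl⟩, ht⟩

/-- The boundary operator `∂ σ = ∑ᵢ (-1)ⁱ dᵢ σ`, extended to closed-support chains. -/
def boundary (R : Type*) [CommRing R] (n : ℕ) (X : Type*) [TopologicalSpace X] :
    Chain R (n + 1) X →ₗ[R] Chain R n X :=
  ∑ i : Fin (n + 2), (-1 : R) ^ (i : ℕ) • push (face i) (face_admissible i)

/-- Closed-support cycles (every `0`-chain is a cycle). -/
def cycles (R : Type*) [CommRing R] (n : ℕ) (X : Type*) [TopologicalSpace X] :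
    Submodule R (Chain R n X) :=
  match n with
  | 0 => ⊤
  | n + 1 => LinearMap.ker (boundary R n X)

/-- Homology with closed supports `Hᶜ_n(X; R)`: cycles modulo boundaries. -/
abbrev Homology (R : Type*) [CommRing R] (n : ℕ) (X : Type*) [TopologicalSpace X] : Type _ :=
  cycles R n X ⧸ (LinearMap.range (boundary R n X)).comap (cycles R n X).subtype

/-- The class of a cycle. -/
abbrev Homology.mk {R : Type*} [CommRing R] {n : ℕ} {X : Type*} [TopologicalSpace X]
    (c : cycles R n X) : Homology R n X :=
  Submodule.Quotient.mk c

section functoriality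

variable {X Y : Type*} [TopologicalSpace X] [TopologicalSpace Y]

theorem comp_admissible (n : ℕ) (φ : C(X, Y)) (hφ : IsProperMap φ) :
    Admissible (fun σ : Simplex n X => φ.comp σ) := by
  intro K hK
  refine ⟨φ ⁻¹' K, hφ.isCompact_preimage hK, ?_⟩
  rintro σ ⟨_, ⟨t, rfl⟩, ht⟩
  exact ⟨_, ⟨t, rfl⟩, ht⟩

/-- The chain map `σ ↦ φ ∘ σ` induced by a proper continuous map `φ`. -/
def chainMap (R : Type*) [CommRing R] (n : ℕ) (φ : C(X, Y)) (hφ : IsProperMap φ) :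
    Chain R n X →ₗ[R] Chain R n Y :=
  push (fun σ => φ.comp σ) (comp_admissible n φ hφ)

theorem boundary_chainMap (R : Type*) [CommRing R] (n : ℕ) (φ : C(X, Y)) (hφ : IsProperMap φ)
    (c : Chain R (n + 1) X) :
    boundary R n Y (chainMap R (n + 1) φ hφ c) = chainMap R n φ hφ (boundary R n X c) := by
  simp only [boundary, chainMap, LinearMap.sum_apply, LinearMap.smul_apply, map_sum, map_smul]
  refine Finset.sum_congr rfl fun i _ => ?_
  have hk : Admissible (fun σ : Simplex (n + 1) X => φ.comp (face i σ)) := by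
    intro K hK
    obtain ⟨L, hL, h⟩ := comp_admissible n φ hφ K hK
    obtain ⟨L', hL', h'⟩ := face_admissible i L hL
    exact ⟨L', hL', fun σ hσ => h' σ (h _ hσ)⟩
  have h1 := push_push _ (comp_admissible (n + 1) φ hφ) _ (face_admissible i)
    (fun σ : Simplex (n + 1) X => φ.comp (face i σ)) hk (fun σ => rfl) c
  have h2 := push_push _ (face_admissible i) _ (comp_admissible n φ hφ)
    (fun σ : Simplex (n + 1) X => φ.comp (face i σ)) hk (fun σ => rfl) c
  rw [h1, h2]

theorem chainMap_mem_cycles (R : Type*) [CommRing R] (n : ℕ) (φ : C(X, Y)) (hφ : IsProperMap φ)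
    (c : Chain R n X) (hc : c ∈ cycles R n X) : chainMap R n φ hφ c ∈ cycles R n Y := by
  cases n with
  | zero => trivial
  | succ n =>
    have h : boundary R n X c = 0 := hc
    change boundary R n Y _ = 0
    rw [boundary_chainMap, h, map_zero]

/-- The map on cycles induced by a proper map. -/
def cyclesMap (R : Type*) [CommRing R] (n : ℕ) (φ : C(X, Y)) (hφ : IsProperMap φ) :
    cycles R n X →ₗ[R] cycles R n Y :=
  (chainMap R n φ hφ).restrict (chainMap_mem_cycles R n φ hφ)

/-- The map `φ_* : Hᶜ_n(X; R) → Hᶜ_n(Y; R)` induced by a proper map `φ`. -/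
def homologyMap (R : Type*) [CommRing R] (n : ℕ) (φ : C(X, Y)) (hφ : IsProperMap φ) :
    Homology R n X →ₗ[R] Homology R n Y :=
  Submodule.mapQ _ _ (cyclesMap R n φ hφ) (by
    rintro ⟨c, hc⟩ ⟨b, hb⟩
    refine ⟨chainMap R (n + 1) φ hφ b, ?_⟩
    rw [boundary_chainMap, hb]
    rfl)

end functoriality

/-- The chains none of whose simplices passes through `x`. -/
def avoiding (R : Type*) [CommRing R] (n : ℕ) {X : Type*} [TopologicalSpace X] (x : X) :
    Submodule R (Chain R n X) where
  carrier := {c | ∀ σ : Simplex n X, x ∈ Set.range σ → c.1 σ = 0}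
  zero_mem' := fun _ _ => rfl
  add_mem' := by
    intro a b ha hb σ hσ
    change a.1 σ + b.1 σ = 0
    rw [ha σ hσ, hb σ hσ, add_zero]
  smul_mem' := by
    intro r a ha σ hσ
    change r * a.1 σ = 0
    rw [ha σ hσ, mul_zero]

/-- The `n`-chains representing a class in the local homology `H_n(X, X ∖ {x}; R)`. Only finitely
many simplices of a closed-support chain pass through `x`, so modulo the chains avoiding `x`
closed-support chains are the same as finite chains. -/
def relCycles (R : Type*) [CommRing R] {X : Type*} [TopologicalSpace X] (x : X) :
    (n : ℕ) → Submodule R (Chain R n X)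
  | 0 => ⊤
  | n + 1 => (avoiding R n x).comap (boundary R n X)

/-- The `n`-chains that represent zero in `H_n(X, X ∖ {x}; R)`. -/
def relBoundaries (R : Type*) [CommRing R] {X : Type*} [TopologicalSpace X] (x : X) (n : ℕ) :
    Submodule R (Chain R n X) :=
  LinearMap.range (boundary R n X) ⊔ avoiding R n x

/-- `μ ∈ Hᶜ_n(X; R)` is an `R`-fundamental class of `X`: for every point `x` its restriction
generates the `R`-module `H_n(X, X ∖ {x}; R)`. -/
def IsFundamentalClass {R : Type*} [CommRing R] {n : ℕ} {X : Type*} [TopologicalSpace X]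
    (μ : Homology R n X) : Prop :=
  ∀ c : cycles R n X, Homology.mk c = μ →
    ∀ x : X, relCycles R x n ≤ Submodule.span R {(c : Chain R n X)} ⊔ relBoundaries R x n

end ClosedSupport

/-! ### Real algebraic curves in `(ℝ*)²` and their logarithmic images -/

/-- The curve `ℝV = {z ∈ (ℝ*)² | f(z) = 0}`. -/
def realCurve (f : MvPolynomial (Fin 2) ℝ) : Set (Fin 2 → ℝ) :=
  {z | (∀ i, z i ≠ 0) ∧ MvPolynomial.eval z f = 0}

/-- `ℝV` is non-singular: the gradient of `f` does not vanish at any point of `ℝV`. -/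
def IsNonsingularCurve (f : MvPolynomial (Fin 2) ℝ) : Prop :=
  ∀ z ∈ realCurve f, ∃ i, MvPolynomial.eval z (MvPolynomial.pderiv i f) ≠ 0

/-- The map `Log(z₁, z₂) = (log |z₁|, log |z₂|)` restricted to `ℝV`. -/
def logCurve (f : MvPolynomial (Fin 2) ℝ) : C(realCurve f, Fin 2 → ℝ) where
  toFun z := fun i => Real.log |(z : Fin 2 → ℝ) i|
  continuous_toFun := by
    refine continuous_pi fun i => ?_
    refine Continuous.log ?_ fun z => ?_
    · exact ((continuous_apply i).comp continuous_subtype_val).abs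
    exact abs_ne_zero.2 (z.2.1 i)

theorem isProperMap_logCurve (f : MvPolynomial (Fin 2) ℝ) : IsProperMap (logCurve f) := by
  rw [isProperMap_iff_isCompact_preimage]
  refine ⟨(logCurve f).continuous, fun K hK => ?_⟩
  obtain ⟨B, hB⟩ := hK.isBounded.exists_norm_le
  have hb : ∀ y ∈ K, ∀ i, |y i| ≤ B := fun y hy i => (norm_le_pi_norm y i).trans (hB y hy)
  rw [Subtype.isCompact_iff]
  let A : Set (Fin 2 → ℝ) := {z | (∀ i, Real.exp (-B) ≤ |z i|) ∧ (∀ i, |z i| ≤ Real.exp B)}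
  have hA : IsClosed A := by
    refine IsClosed.inter ?_ ?_
    · have h := isClosed_iInter fun i : Fin 2 =>
        isClosed_le (f := fun _ : Fin 2 → ℝ => Real.exp (-B)) (g := fun z => |z i|)
          (by fun_prop) (by fun_prop)
      rwa [← Set.ofPred_forall] at h
    · have h := isClosed_iInter fun i : Fin 2 =>
        isClosed_le (f := fun z : Fin 2 → ℝ => |z i|) (g := fun _ => Real.exp B)
          (by fun_prop) (by fun_prop)
      rwa [← Set.ofPred_forall] at h
  have hAb : Bornology.IsBounded A := by
    refine isBounded_iff_forall_norm_le.2 ⟨Real.exp B, fun z hz => ?_⟩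
    exact (pi_norm_le_iff_of_nonneg (Real.exp_pos B).le).2 fun i => hz.2 i
  have hA0 : ∀ z ∈ A, ∀ i, z i ≠ 0 := fun z hz i =>
    abs_pos.1 ((Real.exp_pos _).trans_le (hz.1 i))
  have hlog : ContinuousOn (fun z : Fin 2 → ℝ => fun i => Real.log |z i|) A := by
    refine continuousOn_pi.2 fun i => ?_
    refine ContinuousOn.log (by fun_prop) fun z hz => ?_
    exact abs_ne_zero.2 (hA0 z hz i)
  have hev : IsClosed {z : Fin 2 → ℝ | MvPolynomial.eval z f = 0} :=
    isClosed_eq (MvPolynomial.continuous_eval f) continuous_const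
  have hc := ((hlog.preimage_isClosed_of_isClosed hA hK.isClosed).inter hev)
  have hcomp := Metric.isCompact_of_isClosed_isBounded hc
    ((hAb.subset Set.inter_subset_left).subset Set.inter_subset_left)
  have heq : Subtype.val '' (logCurve f ⁻¹' K) =
      (A ∩ (fun z : Fin 2 → ℝ => fun i => Real.log |z i|) ⁻¹' K) ∩
        {z | MvPolynomial.eval z f = 0} := ?_
  · rw [heq]
    exact hcomp
  ext z
  constructor
  · rintro ⟨w, hw, rfl⟩
    refine ⟨⟨⟨fun i => ?_, fun i => ?_⟩, hw⟩, w.2.2⟩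
    · rw [← Real.le_log_iff_exp_le (abs_pos.2 (w.2.1 i))]
      exact (abs_le.1 (hb _ hw i)).1
    · rw [← Real.log_le_iff_le_exp (abs_pos.2 (w.2.1 i))]
      exact (abs_le.1 (hb _ hw i)).2
  · rintro ⟨⟨hz, hzK⟩, hzf⟩
    exact ⟨⟨z, hA0 z hz, hzf⟩, hzK, rfl⟩

end

/-! Statements 2 and 3 hold because every locally finite 1-cycle of the plane bounds; of the curve
only the properness of `Log` is used. The proof is an Eilenberg swindle. Let D be the time-one map
of a proper homotopy starting at the identity. If the iterates D^k c run off to infinity, then S = ∑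
D^k c is a locally finite chain with DS − S = −c, so the prism over S bounds −c up to the trace of
∂S (`exists_boundary_of_locFin_iterate`). Dilation by 2 disposes in this way of every cycle that
avoids the origin (`exists_boundary_of_mem_avoiding`). A general cycle is split into the finitely
many simplices through the origin and the rest. The finite part is translated to infinity, in a
direction for which the trace of its boundary misses the origin; that trace is absorbed into the
rest, which dilation then removes (`exists_boundary_add`, `exists_boundary_plane`).

For statement 1, the gradient of f in logarithmic coordinates, rotated and normalized, gives a
bounded, hence complete, vector field tangent to the curve. On a non-singular curve it has no zeros,
so its orbit maps are local homeomorphisms (`exists_etaleFlow`). Each orbit is cut into arcs of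
equal length. The sum of all arcs is a locally finite cycle (`boundary_fundamentalChain`), and near
a point p it is a single arc through p (`relClass_fundamentalChain`). Such an arc generates the
local homology at p: paths are subdivided into pieces that miss p or lie in an arc neighbourhood of
p (`relClass_mem_span`). -/

noncomputable section

namespace ClosedSupport

/-! ### Locally finite chains: coefficients, local operators, infinite sums -/

section coefficients

variable {R : Type*} [CommRing R] {n m : ℕ} {X Y : Type*} [TopologicalSpace X]
  [TopologicalSpace Y]

/-- The coefficient of a simplex, as a linear functional on chains. -/
def coeff (R : Type*) [CommRing R] {n : ℕ} {X : Type*} [TopologicalSpace X] (σ : Simplex n X) :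
    Chain R n X →ₗ[R] R where
  toFun c := c.1 σ
  map_add' _ _ := rfl
  map_smul' _ _ := rfl

theorem Chain.ext_coeff {a b : Chain R n X} (h : ∀ σ, coeff R σ a = coeff R σ b) : a = b :=
  Chain.ext h

open Classical in
/-- The chain consisting of a single simplex. -/
def single (R : Type*) [CommRing R] {n : ℕ} {X : Type*} [TopologicalSpace X] (σ : Simplex n X) :
    Chain R n X :=
  ⟨Pi.single σ 1, fun _ _ => (Set.finite_singleton σ).subset fun τ hτ => by
    by_contra h
    exact hτ.1 (Pi.single_eq_of_ne h 1)⟩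

@[simp]
theorem coeff_single_self (σ : Simplex n X) : coeff R σ (single R σ) = 1 := by
  classical
  exact Pi.single_eq_same (M := fun _ => R) σ 1

theorem coeff_single_of_ne {σ τ : Simplex n X} (h : τ ≠ σ) : coeff R τ (single R σ) = 0 := by
  classical
  exact Pi.single_eq_of_ne (M := fun _ => R) h 1

theorem exists_of_coeff_push_ne_zero {g : Simplex m X → Simplex n Y} {hg : Admissible g}
    {c : Chain R m X} {τ : Simplex n Y} (h : coeff R τ (push g hg c) ≠ 0) :
    ∃ σ, g σ = τ ∧ coeff R σ c ≠ 0 := by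
  obtain ⟨σ, hσ, h1⟩ := exists_ne_zero_of_finsum_mem_ne_zero (show
    ∑ᶠ σ ∈ {σ | g σ = τ}, c.1 σ ≠ 0 from h)
  exact ⟨σ, hσ, h1⟩

theorem push_single (g : Simplex m X → Simplex n Y) (hg : Admissible g) (σ : Simplex m X) :
    push g hg (single R σ) = single R (g σ) := by
  refine Chain.ext_coeff fun τ => ?_
  by_cases h : τ = g σ
  · subst h
    rw [coeff_single_self]
    change ∑ᶠ ρ ∈ {ρ | g ρ = g σ}, coeff R ρ (single R σ) = 1
    rw [finsum_eq_single _ σ fun ρ h => by simp [coeff_single_of_ne h]]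
    simp
  · rw [coeff_single_of_ne h]
    by_contra h1
    obtain ⟨ρ, rfl, h2⟩ := exists_of_coeff_push_ne_zero h1
    refine h2 (coeff_single_of_ne ?_)
    rintro rfl
    exact h rfl

theorem push_id (h : Admissible (id : Simplex n X → Simplex n X)) (c : Chain R n X) :
    push id h c = c := by
  refine Chain.ext fun τ => ?_
  rw [push_apply]
  simp

/-- A linear operator on chains is local if the part of the image near a compact set only depends
on the part of the chain near some compact set. -/
def IsLocal (A : Chain R m X →ₗ[R] Chain R n Y) : Prop :=
  ∀ K : Set Y, IsCompact K → ∃ L : Set X, IsCompact L ∧ ∀ c : Chain R m X,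
    (∀ σ : Simplex m X, (Set.range σ ∩ L).Nonempty → coeff R σ c = 0) →
      ∀ τ : Simplex n Y, (Set.range τ ∩ K).Nonempty → coeff R τ (A c) = 0

theorem isLocal_push (g : Simplex m X → Simplex n Y) (hg : Admissible g) :
    IsLocal (push (R := R) g hg) := by
  intro K hK
  obtain ⟨L, hL, h⟩ := hg K hK
  refine ⟨L, hL, fun c hc τ hτ => ?_⟩
  by_contra h1
  obtain ⟨σ, rfl, h2⟩ := exists_of_coeff_push_ne_zero h1
  exact h2 (hc σ (h σ hτ))

theorem isLocal_sum_smul {ι : Type*} (s : Finset ι) (a : ι → R)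
    (A : ι → Chain R m X →ₗ[R] Chain R n Y) (hA : ∀ i, IsLocal (A i)) :
    IsLocal (∑ i ∈ s, a i • A i) := by
  intro K hK
  choose L hL h using fun i => hA i K hK
  refine ⟨⋃ i ∈ s, L i, s.isCompact_biUnion fun i _ => hL i, fun c hc τ hτ => ?_⟩
  rw [LinearMap.sum_apply, map_sum]
  refine Finset.sum_eq_zero fun i hi => ?_
  rw [LinearMap.smul_apply, map_smul, h i c (fun σ hσ => hc σ ?_) τ hτ, smul_zero]
  exact hσ.mono (Set.inter_subset_inter_right _ (Set.subset_biUnion_of_mem (u := L) hi))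

theorem isLocal_boundary : IsLocal (boundary R n X) :=
  isLocal_sum_smul _ _ _ fun i => isLocal_push _ (face_admissible i)

/-- A family of chains is locally finite if only finitely many of them meet a compact set. -/
def LocFin {ι : Type*} (F : ι → Chain R n X) : Prop :=
  ∀ K : Set X, IsCompact K →
    {i | ∃ σ : Simplex n X, (Set.range σ ∩ K).Nonempty ∧ coeff R σ (F i) ≠ 0}.Finite

variable {ι : Type*}

theorem LocFin.finite_support {F : ι → Chain R n X} (hF : LocFin F) (σ : Simplex n X) :
    (Function.support fun i => coeff R σ (F i)).Finite :=
  (hF (Set.range σ) (isCompact_range σ.continuous)).subset fun _ hi =>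
    ⟨σ, by simpa using Set.range_nonempty σ, hi⟩

theorem LocFin.map {F : ι → Chain R m X} (hF : LocFin F) {A : Chain R m X →ₗ[R] Chain R n Y}
    (hA : IsLocal A) : LocFin fun i => A (F i) := by
  intro K hK
  obtain ⟨L, hL, h⟩ := hA K hK
  refine (hF L hL).subset ?_
  rintro i ⟨τ, hτ, h1⟩
  by_contra h2
  refine h1 (h (F i) (fun σ hσ => ?_) τ hτ)
  by_contra h3
  exact h2 ⟨σ, hσ, h3⟩

/-- The sum of a locally finite family of chains. -/
def lfSum (F : ι → Chain R n X) (hF : LocFin F) : Chain R n X :=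
  ⟨fun σ => ∑ᶠ i, coeff R σ (F i), by
    intro K hK
    refine ((hF K hK).biUnion fun i _ => (F i).2 K hK).subset ?_
    rintro σ ⟨h, hσ⟩
    obtain ⟨i, hi⟩ : ∃ i, coeff R σ (F i) ≠ 0 := by
      by_contra! h1
      exact h (by simp [h1])
    exact Set.mem_biUnion (show i ∈ {i | _} from ⟨σ, hσ, hi⟩) ⟨hi, hσ⟩⟩

theorem coeff_lfSum (F : ι → Chain R n X) (hF : LocFin F) (σ : Simplex n X) :
    coeff R σ (lfSum F hF) = ∑ᶠ i, coeff R σ (F i) := rfl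

/-- Linearity only covers finite sums. By locality, the coefficient of `A` at `τ` depends on the
chain near one compact set `L`, where all but finitely many terms vanish. -/
theorem map_lfSum (F : ι → Chain R m X) (hF : LocFin F) {A : Chain R m X →ₗ[R] Chain R n Y}
    (hA : IsLocal A) : A (lfSum F hF) = lfSum (fun i => A (F i)) (hF.map hA) := by
  refine Chain.ext_coeff fun τ => ?_
  obtain ⟨L, hL, h⟩ := hA (Set.range τ) (isCompact_range τ.continuous)
  have hτ : (Set.range τ ∩ Set.range τ).Nonempty := by simpa using Set.range_nonempty τ
  have hT := hF L hL
  have h1 : coeff R τ (A (lfSum F hF - ∑ i ∈ hT.toFinset, F i)) = 0 := by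
    refine h _ (fun σ hσ => ?_) τ hτ
    rw [map_sub, map_sum, coeff_lfSum, sub_eq_zero]
    refine finsum_eq_sum_of_support_subset _ fun i hi => ?_
    simpa using ⟨σ, hσ, hi⟩
  rw [map_sub, map_sub, sub_eq_zero] at h1
  rw [h1, coeff_lfSum, map_sum, map_sum]
  refine (finsum_eq_sum_of_support_subset _ fun i hi => ?_).symm
  simp only [Set.Finite.coe_toFinset, Set.mem_ofPred_eq]
  by_contra h2
  refine hi (h (F i) (fun σ hσ => ?_) τ hτ)
  by_contra h3
  exact h2 ⟨σ, hσ, h3⟩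

open Classical in
/-- The coefficients of the restriction of a chain to a finite set of simplices. -/
theorem sum_coeff_smul_single (c : Chain R n X) (T : Finset (Simplex n X)) (τ : Simplex n X) :
    coeff R τ (∑ σ ∈ T, coeff R σ c • single R σ) = if τ ∈ T then coeff R τ c else 0 := by
  rw [map_sum]
  split_ifs with h
  · rw [Finset.sum_eq_single_of_mem τ h]
    · simp
    · intro σ _ hσ
      rw [map_smul, coeff_single_of_ne hσ.symm, smul_zero]
  · refine Finset.sum_eq_zero fun σ hσ => ?_
    rw [map_smul, coeff_single_of_ne, smul_zero]
    rintro rfl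
    exact h hσ

end coefficients

/-! ### Affine simplices, and singular 1-simplices as paths -/

section affine

variable {R : Type*} [CommRing R] {n : ℕ} {X : Type*} [TopologicalSpace X]
  {V : Type*} [AddCommGroup V] [Module ℝ V] [TopologicalSpace V] [IsTopologicalAddGroup V]
  [ContinuousSMul ℝ V]

/-- The image under `g` of the affine simplex with the given vertices. -/
def affineSimplex (g : C(V, X)) (p : Fin (n + 1) → V) : Simplex n X :=
  g.comp ⟨fun s => ∑ i, s.1 i • p i, continuous_finsetSum _ fun i _ =>
    ((continuous_apply i).comp continuous_subtype_val).smul continuous_const⟩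

theorem affineSimplex_apply (g : C(V, X)) (p : Fin (n + 1) → V) (s : stdSimplex ℝ (Fin (n + 1))) :
    affineSimplex g p s = g (∑ i, s.1 i • p i) := rfl

theorem face_affineSimplex (g : C(V, X)) (p : Fin (n + 2) → V) (i : Fin (n + 2)) :
    face i (affineSimplex g p) = affineSimplex g (p ∘ i.succAbove) := by
  ext s
  change g (∑ j, (FunOnFinite.linearMap ℝ ℝ i.succAbove s) j • p j) = _
  rw [affineSimplex_apply]
  congr 1
  simp only [FunOnFinite.linearMap_apply_apply, Finset.sum_smul, Function.comp]
  rw [← Finset.sum_fiberwise Finset.univ i.succAbove (fun k => s.1 k • p (i.succAbove k))]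
  refine Finset.sum_congr rfl fun j _ => Finset.sum_congr rfl fun k hk => ?_
  rw [(Finset.mem_filter.1 hk).2]
  rfl

/-- The singular `0`-simplex at a point. -/
def pt (x : X) : Simplex 0 X := ContinuousMap.const _ x

theorem pt_injective : Function.Injective (pt : X → Simplex 0 X) := fun _ _ h =>
  DFunLike.congr_fun h (Classical.arbitrary (stdSimplex ℝ (Fin 1)))

theorem stdSimplex_zero_eq_one (s : stdSimplex ℝ (Fin (0 + 1))) : s.1 0 = 1 := by
  have h := s.2.2
  rwa [Fin.sum_univ_succ, Fin.sum_univ_zero, add_zero] at h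

theorem exists_eq_pt (σ : Simplex 0 X) : ∃ x, σ = pt x := by
  refine ⟨σ (Classical.arbitrary _), ?_⟩
  ext s
  change σ s = σ _
  congr 1
  ext i
  fin_cases i
  exact (stdSimplex_zero_eq_one s).trans (stdSimplex_zero_eq_one _).symm

theorem range_pt (x : X) : Set.range (pt x) = {x} :=
  Set.range_const

/-- The image under `g` of the segment from `a` to `b`. -/
def seg (g : C(V, X)) (a b : V) : Simplex 1 X := affineSimplex g ![a, b]

/-- The image under `g` of the triangle with vertices `a`, `b`, `c`. -/
def tri (g : C(V, X)) (a b c : V) : Simplex 2 X := affineSimplex g ![a, b, c]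

theorem seg_apply (g : C(V, X)) (a b : V) (s : stdSimplex ℝ (Fin 2)) :
    seg g a b s = g (s.1 0 • a + s.1 1 • b) := by
  refine (affineSimplex_apply (n := 1) g ![a, b] s).trans ?_
  rw [Fin.sum_univ_two]
  rfl

theorem tri_apply (g : C(V, X)) (a b c : V) (s : stdSimplex ℝ (Fin 3)) :
    tri g a b c s = g (s.1 0 • a + s.1 1 • b + s.1 2 • c) := by
  refine (affineSimplex_apply (n := 2) g ![a, b, c] s).trans ?_
  rw [Fin.sum_univ_three]
  rfl

theorem face_zero_seg (g : C(V, X)) (a b : V) :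
    face 0 (seg g a b) = pt (g b) := by
  refine (face_affineSimplex g ![a, b] _).trans ?_
  ext s
  rw [affineSimplex_apply, Fin.sum_univ_succ, Fin.sum_univ_zero, add_zero,
    stdSimplex_zero_eq_one, one_smul]
  rfl

theorem face_one_seg (g : C(V, X)) (a b : V) :
    face 1 (seg g a b) = pt (g a) := by
  refine (face_affineSimplex g ![a, b] _).trans ?_
  ext s
  rw [affineSimplex_apply, Fin.sum_univ_succ, Fin.sum_univ_zero, add_zero,
    stdSimplex_zero_eq_one, one_smul]
  rfl

theorem boundary_zero_apply (c : Chain R 1 X) :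
    boundary R 0 X c = push (face 0) (face_admissible 0) c - push (face 1) (face_admissible 1) c := by
  simp [boundary, Fin.sum_univ_two, sub_eq_add_neg]

theorem boundary_one_apply (c : Chain R 2 X) :
    boundary R 1 X c = push (face 0) (face_admissible 0) c - push (face 1) (face_admissible 1) c
      + push (face 2) (face_admissible 2) c := by
  simp [boundary, Fin.sum_univ_three, sub_eq_add_neg]

theorem boundary_single (σ : Simplex 1 X) :
    boundary R 0 X (single R σ) = single R (face 0 σ) - single R (face 1 σ) := by
  rw [boundary_zero_apply, push_single, push_single]

theorem face_tri (g : C(V, X)) (a b c : V) :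
    face 0 (tri g a b c) = seg g b c ∧
    face 1 (tri g a b c) = seg g a c ∧
    face 2 (tri g a b c) = seg g a b := by
  refine ⟨?_, ?_, ?_⟩
  all_goals
    refine (face_affineSimplex g ![a, b, c] _).trans (congrArg _ (funext fun i => ?_))
    fin_cases i <;> rfl

theorem boundary_tri (g : C(V, X)) (a b c : V) :
    boundary R 1 X (single R (tri g a b c)) =
      single R (seg g b c) - single R (seg g a c)
        + single R (seg g a b) := by
  obtain ⟨h0, h1, h2⟩ := face_tri g a b c
  rw [boundary_one_apply, push_single, push_single, push_single, h0, h1, h2]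

/-- A singular `1`-simplex as a path, extended to the line by constants. -/
def path (σ : Simplex 1 X) : C(ℝ, X) :=
  σ.comp (⟨fun t => stdSimplexHomeomorphUnitInterval.symm (Set.projIcc 0 1 zero_le_one t),
    by fun_prop⟩ : C(ℝ, stdSimplex ℝ (Fin 2)))

theorem path_apply_coord (σ : Simplex 1 X) (s : stdSimplex ℝ (Fin 2)) : path σ (s.1 1) = σ s := by
  change σ (stdSimplexHomeomorphUnitInterval.symm (Set.projIcc 0 1 zero_le_one (s.1 1))) = σ s
  congr 1
  rw [Homeomorph.symm_apply_eq]
  ext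
  rw [Set.projIcc_of_mem zero_le_one (mem_Icc_of_mem_stdSimplex s.2 1)]
  rfl

/-- Every 1-simplex is thus an affine segment under a map from `ℝ`, so that the rules for segments
and triangles apply to it. -/
theorem seg_path (σ : Simplex 1 X) : seg (path σ) (0 : ℝ) 1 = σ := by
  ext s
  rw [seg_apply, ← path_apply_coord]
  simp

theorem path_mem_range (σ : Simplex 1 X) (t : ℝ) : path σ t ∈ Set.range σ := ⟨_, rfl⟩

theorem face_zero_eq (σ : Simplex 1 X) : face 0 σ = pt (path σ 1) := by
  conv_lhs => rw [← seg_path σ]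
  exact face_zero_seg _ _ _

theorem face_one_eq (σ : Simplex 1 X) : face 1 σ = pt (path σ 0) := by
  conv_lhs => rw [← seg_path σ]
  exact face_one_seg _ _ _

theorem range_seg (g : C(ℝ, X)) (a b : ℝ) : Set.range (seg g a b) = g '' Set.uIcc a b := by
  rw [← segment_eq_uIcc]
  ext x
  constructor
  · rintro ⟨s, rfl⟩
    exact ⟨_, ⟨s.1 0, s.1 1, s.2.1 0, s.2.1 1, stdSimplex.add_eq_one s, rfl⟩,
      (seg_apply _ _ _ _).symm⟩
  · rintro ⟨_, ⟨u, v, hu, hv, huv, rfl⟩, rfl⟩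
    refine ⟨⟨![u, v], ?_, ?_⟩, seg_apply _ _ _ _⟩
    · intro i
      fin_cases i
      · exact hu
      · exact hv
    · simpa [Fin.sum_univ_two] using huv

end affine

/-! ### Proper homotopies, the prism operator and the swindle -/

section homotopy

theorem finsum_eq_zero_add_of_finite_support {M : Type*} [AddCommMonoid M] {f : ℕ → M}
    (hf : f.support.Finite) : ∑ᶠ k, f k = f 0 + ∑ᶠ k, f (k + 1) := by
  obtain ⟨N, hN⟩ := hf.bddAbove
  rw [finsum_eq_sum_of_support_subset (s := Finset.range (N + 1 + 1)),
    finsum_eq_sum_of_support_subset (s := Finset.range (N + 1)), Finset.sum_range_succ', add_comm]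
  · intro k hk
    have := hN (a := k + 1) hk
    simp only [Finset.coe_range, Set.mem_Iio]
    omega
  · intro k hk
    have := hN (a := k) hk
    simp only [Finset.coe_range, Set.mem_Iio]
    omega

variable {R : Type*} [CommRing R] {n m : ℕ} {X : Type*} [TopologicalSpace X]

theorem exists_of_coeff_boundary_ne_zero {c : Chain R (n + 1) X} {τ : Simplex n X}
    (h : coeff R τ (boundary R n X c) ≠ 0) : ∃ σ i, face i σ = τ ∧ coeff R σ c ≠ 0 := by
  simp only [boundary, LinearMap.sum_apply, LinearMap.smul_apply, map_sum, map_smul] at h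
  obtain ⟨i, _, hi⟩ := Finset.exists_ne_zero_of_sum_ne_zero h
  obtain ⟨σ, h1, h2⟩ := exists_of_coeff_push_ne_zero (right_ne_zero_of_smul hi)
  exact ⟨σ, i, h1, h2⟩

theorem range_face_subset (i : Fin (n + 2)) (σ : Simplex (n + 1) X) :
    Set.range (face i σ) ⊆ Set.range σ := by
  rintro _ ⟨s, rfl⟩
  exact ⟨_, rfl⟩

theorem boundary_mem_avoiding {x : X} {c : Chain R (n + 1) X} (hc : c ∈ avoiding R (n + 1) x) :
    boundary R n X c ∈ avoiding R n x := by
  intro τ hτ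
  by_contra h
  obtain ⟨σ, i, rfl, h2⟩ := exists_of_coeff_boundary_ne_zero h
  exact h2 (hc σ (range_face_subset i σ hτ))

theorem push_face_face (i j i' j')
    (h : ∀ σ : Simplex 2 X, face (n := 0) i (face j σ) = face (n := 0) i' (face j' σ))
    (c : Chain R 2 X) :
    push (face i) (face_admissible i) (push (face j) (face_admissible j) c) =
      push (face i') (face_admissible i') (push (face j') (face_admissible j') c) := by
  have hk : Admissible (fun σ : Simplex 2 X => face (n := 0) i (face j σ)) := by
    intro K hK
    obtain ⟨L, hL, h⟩ := face_admissible (X := X) (n := 0) i K hK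
    obtain ⟨L', hL', h'⟩ := face_admissible (X := X) (n := 1) j L hL
    exact ⟨L', hL', fun σ hσ => h' σ (h _ hσ)⟩
  rw [push_push _ _ _ _ _ hk (fun σ => rfl) c, push_push _ _ _ _ _ hk (fun σ => (h σ).symm) c]

theorem face_face_eq (i j i' j')
    (h : ∀ k, Fin.succAbove (n := 2) j (Fin.succAbove (n := 1) i k) =
      Fin.succAbove (n := 2) j' (Fin.succAbove (n := 1) i' k)) (σ : Simplex 2 X) :
    face (n := 0) i (face j σ) = face (n := 0) i' (face j' σ) := by
  ext s
  change σ (stdSimplex.map _ (stdSimplex.map _ s)) = σ (stdSimplex.map _ (stdSimplex.map _ s))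
  rw [stdSimplex.map_comp_apply, stdSimplex.map_comp_apply]
  congr 2
  exact funext h

theorem boundary_boundary (c : Chain R 2 X) : boundary R 0 X (boundary R 1 X c) = 0 := by
  rw [boundary_one_apply, boundary_zero_apply]
  simp only [map_sub, map_add]
  rw [push_face_face 0 0 0 1 (face_face_eq _ _ _ _ (by decide)),
    push_face_face 1 0 0 2 (face_face_eq _ _ _ _ (by decide)),
    push_face_face 1 1 1 2 (face_face_eq _ _ _ _ (by decide))]
  abel

/-- A homotopy `φ` whose part over the unit interval is proper. -/
def ProperHomotopy (φ : C(ℝ × X, X)) : Prop :=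
  ∀ K : Set X, IsCompact K → ∃ L : Set X, IsCompact L ∧
    ∀ l ∈ Set.Icc (0 : ℝ) 1, ∀ x, φ (l, x) ∈ K → x ∈ L

theorem ProperHomotopy.admissible {φ : C(ℝ × X, X)} (hφ : ProperHomotopy φ)
    {g : Simplex m X → Simplex n X}
    (hg : ∀ (σ : Simplex m X) s, ∃ l ∈ Set.Icc (0 : ℝ) 1, ∃ x ∈ Set.range σ, g σ s = φ (l, x)) :
    Admissible g := by
  intro K hK
  obtain ⟨L, hL, h⟩ := hφ K hK
  refine ⟨L, hL, ?_⟩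
  rintro σ ⟨_, ⟨s, rfl⟩, hs⟩
  obtain ⟨l, hl, x, hx, e⟩ := hg σ s
  exact ⟨x, hx, h l hl x (e ▸ hs)⟩

/-- The trace of a point under a homotopy. -/
def trace (φ : C(ℝ × X, X)) (σ : Simplex 0 X) : Simplex 1 X :=
  seg (φ.comp ⟨fun l : ℝ => (l, σ (Classical.arbitrary _)), by fun_prop⟩) 0 1

/-- The trace of a path under a homotopy. -/
def rect (φ : C(ℝ × X, X)) (σ : Simplex 1 X) : C(ℝ × ℝ, X) :=
  φ.comp ⟨fun p => (p.1, path σ p.2), by fun_prop⟩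

theorem rect_apply (φ : C(ℝ × X, X)) (σ : Simplex 1 X) (p : ℝ × ℝ) :
    rect φ σ p = φ (p.1, path σ p.2) := rfl

/-- The time-one map of a homotopy. -/
def timeOne (φ : C(ℝ × X, X)) : C(X, X) := φ.comp ⟨fun x => (1, x), by fun_prop⟩

variable {φ : C(ℝ × X, X)}

theorem ProperHomotopy.trace (hφ : ProperHomotopy φ) : Admissible (trace φ) := by
  refine hφ.admissible fun σ s => ⟨s.1 1, mem_Icc_of_mem_stdSimplex s.2 1, _,
    ⟨Classical.arbitrary _, rfl⟩, ?_⟩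
  rw [ClosedSupport.trace, seg_apply]
  simp

theorem ProperHomotopy.rect_seg (hφ : ProperHomotopy φ) :
    Admissible (fun σ => seg (rect φ σ) (0, 0) (1, 1)) := by
  refine hφ.admissible fun σ s => ⟨s.1 1, mem_Icc_of_mem_stdSimplex s.2 1, _,
    path_mem_range σ (s.1 1), ?_⟩
  rw [seg_apply]
  simp [rect_apply]

theorem ProperHomotopy.lower (hφ : ProperHomotopy φ) :
    Admissible (fun σ => tri (rect φ σ) (0, 0) (0, 1) (1, 1)) := by
  refine hφ.admissible fun σ s => ⟨s.1 2, mem_Icc_of_mem_stdSimplex s.2 2, _,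
    path_mem_range σ (s.1 1 + s.1 2), ?_⟩
  rw [tri_apply]
  simp [rect_apply]

theorem ProperHomotopy.upper (hφ : ProperHomotopy φ) :
    Admissible (fun σ => tri (rect φ σ) (0, 0) (1, 0) (1, 1)) := by
  refine hφ.admissible fun σ s => ⟨s.1 1 + s.1 2, ?_, _, path_mem_range σ (s.1 2), ?_⟩
  · have h := s.2.2
    have h0 := s.2.1 0
    have h1 := s.2.1 1
    have h2 := s.2.1 2
    rw [Fin.sum_univ_three] at h
    constructor <;> linarith
  · rw [tri_apply]
    simp [rect_apply]

/-- The prism operator of a homotopy. -/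
def prism (hφ : ProperHomotopy φ) : Chain R 1 X →ₗ[R] Chain R 2 X :=
  push _ hφ.upper - push _ hφ.lower

/-- The square swept out by a path is cut along its diagonal. The two triangles share the diagonal,
which cancels; the four sides are the path, its image at time one, and the traces of its two ends.
-/
theorem boundary_prism (hφ : ProperHomotopy φ) (h0 : ∀ x, φ (0, x) = x)
    (h1 : IsProperMap (timeOne φ)) (c : Chain R 1 X) :
    boundary R 1 X (prism hφ c) + push _ hφ.trace (boundary R 0 X c) =
      chainMap R 1 (timeOne φ) h1 c - c := by
  have hid : Admissible (id : Simplex 1 X → Simplex 1 X) := fun K hK => ⟨K, hK, fun _ h => h⟩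
  have hD := comp_admissible 1 (timeOne φ) h1
  have ht : ∀ i, Admissible (fun σ : Simplex 1 X => trace φ (face i σ)) := by
    intro i K hK
    obtain ⟨L, hL, h⟩ := hφ.trace K hK
    obtain ⟨L', hL', h'⟩ := face_admissible (X := X) (n := 0) i L hL
    exact ⟨L', hL', fun σ hσ => h' σ (h _ hσ)⟩
  have e0 : ∀ σ : Simplex 1 X, seg (rect φ σ) (0, 0) (1, 0) = trace φ (face 1 σ) := by
    intro σ
    ext s
    rw [seg_apply, trace, seg_apply, face_one_eq]
    simp [rect_apply, pt]
  have e1 : ∀ σ : Simplex 1 X, seg (rect φ σ) (0, 1) (1, 1) = trace φ (face 0 σ) := by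
    intro σ
    ext s
    have h2 : s.1 0 + s.1 1 = 1 := stdSimplex.add_eq_one s
    rw [seg_apply, trace, seg_apply, face_zero_eq]
    simp [rect_apply, pt, h2]
  have e2 : ∀ σ : Simplex 1 X, seg (rect φ σ) (0, 0) (0, 1) = id σ := by
    intro σ
    ext s
    rw [seg_apply]
    simp [rect_apply, h0, path_apply_coord]
  have e3 : ∀ σ : Simplex 1 X, seg (rect φ σ) (1, 0) (1, 1) = (timeOne φ).comp σ := by
    intro σ
    ext s
    have h2 : s.1 0 + s.1 1 = 1 := stdSimplex.add_eq_one s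
    rw [seg_apply]
    simp [rect_apply, h2, path_apply_coord, timeOne]
  simp only [prism, LinearMap.sub_apply, map_sub, boundary_one_apply, boundary_zero_apply]
  rw [push_push _ hφ.upper _ (face_admissible 0) _ hD
      (fun σ => (face_tri _ _ _ _).1.trans (e3 σ)),
    push_push _ hφ.upper _ (face_admissible 1) _ hφ.rect_seg (fun σ => (face_tri _ _ _ _).2.1),
    push_push _ hφ.upper _ (face_admissible 2) _ (ht 1)
      (fun σ => (face_tri _ _ _ _).2.2.trans (e0 σ)),
    push_push _ hφ.lower _ (face_admissible 0) _ (ht 0)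
      (fun σ => (face_tri _ _ _ _).1.trans (e1 σ)),
    push_push _ hφ.lower _ (face_admissible 1) _ hφ.rect_seg (fun σ => (face_tri _ _ _ _).2.1),
    push_push _ hφ.lower _ (face_admissible 2) _ hid
      (fun σ => (face_tri _ _ _ _).2.2.trans (e2 σ)),
    push_push _ (face_admissible 0) _ hφ.trace _ (ht 0) (fun σ => rfl),
    push_push _ (face_admissible 1) _ hφ.trace _ (ht 1) (fun σ => rfl), push_id]
  change _ = push _ hD c - c
  abel

theorem exists_of_coeff_chainMap_pow_ne_zero {ψ : C(X, X)} {hψ : IsProperMap ψ} (k : ℕ)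
    {c : Chain R n X} {τ : Simplex n X} (h : coeff R τ ((chainMap R n ψ hψ ^ k) c) ≠ 0) :
    ∃ σ, coeff R σ c ≠ 0 ∧ ∀ s, τ s = ψ^[k] (σ s) := by
  induction k generalizing τ with
  | zero => exact ⟨τ, h, fun _ => rfl⟩
  | succ k ih =>
    rw [pow_succ', Module.End.mul_apply] at h
    obtain ⟨ρ, rfl, h2⟩ := exists_of_coeff_push_ne_zero h
    obtain ⟨σ, h3, h4⟩ := ih h2
    refine ⟨σ, h3, fun s => ?_⟩
    rw [Function.iterate_succ_apply', ← h4]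
    rfl

theorem boundary_chainMap_pow {ψ : C(X, X)} (hψ : IsProperMap ψ) (k : ℕ) (c : Chain R (n + 1) X) :
    boundary R n X ((chainMap R (n + 1) ψ hψ ^ k) c) =
      (chainMap R n ψ hψ ^ k) (boundary R n X c) := by
  induction k with
  | zero => rfl
  | succ k ih =>
    rw [pow_succ', pow_succ', Module.End.mul_apply, Module.End.mul_apply, boundary_chainMap, ih]

/-- If the iterates of the time-one map of a proper homotopy push a chain to infinity, then the
chain bounds up to the trace of the iterates of its boundary. -/
theorem exists_boundary_of_locFin_iterate (hφ : ProperHomotopy φ) (h0 : ∀ x, φ (0, x) = x)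
    (h1 : IsProperMap (timeOne φ)) (c : Chain R 1 X)
    (hc : LocFin fun k : ℕ => (chainMap R 1 (timeOne φ) h1 ^ k) c) :
    ∃ b : Chain R 2 X, ∃ e : Chain R 0 X,
      (∀ τ, coeff R τ e ≠ 0 →
        ∃ k : ℕ, coeff R τ ((chainMap R 0 (timeOne φ) h1 ^ k) (boundary R 0 X c)) ≠ 0) ∧
      boundary R 1 X b + push _ hφ.trace e = -c := by
  -- With S the sum of all iterates, applying the time-one map shifts the sum by one place and loses
  -- only the term `k = 0`, which is `c`.
  refine ⟨prism hφ (lfSum _ hc), boundary R 0 X (lfSum _ hc), ?_, ?_⟩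
  · intro τ hτ
    rw [map_lfSum _ _ isLocal_boundary, coeff_lfSum] at hτ
    by_contra! h
    simp only [boundary_chainMap_pow, h, finsum_zero] at hτ
    exact hτ rfl
  · rw [boundary_prism hφ h0 h1]
    refine (congrArg (· - _) (map_lfSum _ hc
      (isLocal_push _ (comp_admissible 1 (timeOne φ) h1)))).trans ?_
    rw [sub_eq_iff_eq_add]
    refine Chain.ext_coeff fun τ => ?_
    rw [map_add, map_neg, coeff_lfSum, coeff_lfSum,
      finsum_eq_zero_add_of_finite_support (hc.finite_support τ), pow_zero, Module.End.one_apply,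
      neg_add_cancel_left]
    refine finsum_congr fun k => ?_
    rw [pow_succ', Module.End.mul_apply]
    rfl

end homotopy

theorem finite_support_sum_single {R : Type*} [CommRing R] {n : ℕ} {X : Type*}
    [TopologicalSpace X] (c : Chain R n X) (T : Finset (Simplex n X)) :
    {σ | coeff R σ (∑ σ ∈ T, coeff R σ c • single R σ) ≠ 0}.Finite := by
  classical
  refine T.finite_toSet.subset fun σ hσ => ?_
  by_contra h
  rw [Set.mem_ofPred_eq, sum_coeff_smul_single, if_neg (by simpa using h)] at hσ
  exact hσ rfl

/-! ### Translations and dilations; cycles of the plane bound -/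

section vectorSpace

variable {R : Type*} [CommRing R] {n : ℕ} {V : Type*} [NormedAddCommGroup V] [NormedSpace ℝ V]

/-- The homotopy from the identity to the translation by `u`. -/
def translation (u : V) : C(ℝ × V, V) := ⟨fun p => p.2 + p.1 • u, by fun_prop⟩

/-- The homotopy from the identity to the dilation by `2`. -/
def dilation (V : Type*) [NormedAddCommGroup V] [NormedSpace ℝ V] : C(ℝ × V, V) :=
  ⟨fun p => (1 + p.1) • p.2, by fun_prop⟩

theorem isProperMap_timeOne_translation (u : V) : IsProperMap (timeOne (translation u)) := by
  convert! (Homeomorph.addRight u).isProperMap using 1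
  funext x
  simp [timeOne, translation]

theorem isProperMap_timeOne_dilation : IsProperMap (timeOne (dilation V)) := by
  convert! (Homeomorph.smulOfNeZero (2 : ℝ) two_ne_zero (α := V)).isProperMap using 1
  funext x
  simp [timeOne, dilation, one_add_one_eq_two]

theorem iterate_timeOne_translation (u : V) (k : ℕ) (x : V) :
    (timeOne (translation u))^[k] x = x + (k : ℝ) • u := by
  induction k with
  | zero => simp
  | succ k ih =>
    rw [Function.iterate_succ_apply', ih]
    simp only [timeOne, translation, ContinuousMap.comp_apply, ContinuousMap.coe_mk]
    push_cast
    module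

theorem iterate_timeOne_dilation (k : ℕ) (x : V) :
    (timeOne (dilation V))^[k] x = (2 : ℝ) ^ k • x := by
  induction k with
  | zero => simp
  | succ k ih =>
    rw [Function.iterate_succ_apply', ih]
    simp only [timeOne, dilation, ContinuousMap.comp_apply, ContinuousMap.coe_mk, smul_smul,
      one_add_one_eq_two, pow_succ']

/-- A finite chain has bounded support, so the points of its `k`-th translate have norm at least `k
* ‖u‖` minus a constant. -/
theorem locFin_translation {u : V} (hu : u ≠ 0) {c : Chain R n V}
    (hc : {σ | coeff R σ c ≠ 0}.Finite) : LocFin fun k : ℕ =>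
      (chainMap R n (timeOne (translation u)) (isProperMap_timeOne_translation u) ^ k) c := by
  intro K hK
  obtain ⟨B, hB⟩ := hK.isBounded.exists_norm_le
  obtain ⟨B', hB'⟩ := (hc.isCompact_biUnion fun σ _ =>
    isCompact_range σ.continuous).isBounded.exists_norm_le
  refine (Set.finite_Iic ⌈(B + B') / ‖u‖⌉₊).subset ?_
  rintro k ⟨τ, ⟨_, ⟨s, rfl⟩, hs⟩, h⟩
  obtain ⟨σ, h1, h2⟩ := exists_of_coeff_chainMap_pow_ne_zero k h
  rw [h2, iterate_timeOne_translation] at hs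
  have h3 := hB _ hs
  have h4 := hB' (σ s) (Set.mem_biUnion h1 ⟨s, rfl⟩)
  have h5 := norm_sub_le (σ s + (k : ℝ) • u) (σ s)
  rw [add_sub_cancel_left, norm_smul, Real.norm_natCast] at h5
  have h6 : (k : ℝ) ≤ (B + B') / ‖u‖ := by
    rw [le_div_iff₀ (norm_pos_iff.2 hu)]
    linarith
  exact_mod_cast h6.trans (Nat.le_ceil _)

variable [ProperSpace V]

theorem properHomotopy_translation (u : V) : ProperHomotopy (translation u) := by
  intro K hK
  obtain ⟨B, hB⟩ := hK.isBounded.exists_norm_le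
  refine ⟨Metric.closedBall 0 (B + ‖u‖), isCompact_closedBall _ _, fun l hl x hx => ?_⟩
  rw [mem_closedBall_zero_iff]
  have h1 : ‖x + l • u‖ ≤ B := hB _ hx
  have h2 : ‖l • u‖ ≤ ‖u‖ := by
    rw [norm_smul, Real.norm_of_nonneg hl.1]
    exact mul_le_of_le_one_left (norm_nonneg _) hl.2
  have h3 := norm_sub_le (x + l • u) (l • u)
  rw [add_sub_cancel_right] at h3
  linarith

theorem properHomotopy_dilation : ProperHomotopy (dilation V) := by
  intro K hK
  obtain ⟨B, hB⟩ := hK.isBounded.exists_norm_le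
  refine ⟨Metric.closedBall 0 B, isCompact_closedBall _ _, fun l hl x hx => ?_⟩
  rw [mem_closedBall_zero_iff]
  refine le_trans ?_ (hB _ hx)
  change _ ≤ ‖(1 + l) • x‖
  rw [norm_smul, Real.norm_of_nonneg (by linarith [hl.1])]
  exact le_mul_of_one_le_left (norm_nonneg _) (by linarith [hl.1])

/-- Dilations only move points outwards, so what lands in the ball of radius `B` comes from the
finitely many simplices meeting that ball. These stay at distance at least some `m > 0` from the
origin, so `2 ^ k * m ≤ B` bounds `k`. -/
theorem locFin_dilation {c : Chain R n V} (hc : c ∈ avoiding R n (0 : V)) : LocFin fun k : ℕ =>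
    (chainMap R n (timeOne (dilation V)) isProperMap_timeOne_dilation ^ k) c := by
  intro K hK
  obtain ⟨B, hB⟩ := hK.isBounded.exists_norm_le
  have hT := c.2 (Metric.closedBall 0 B) (isCompact_closedBall _ _)
  set T := {σ : Simplex n V | c.1 σ ≠ 0 ∧ (Set.range σ ∩ Metric.closedBall 0 B).Nonempty}
  have hU := (hT.isCompact_biUnion fun σ _ => isCompact_range σ.continuous).isClosed
  have h0 : (0 : V) ∉ ⋃ σ ∈ T, Set.range σ := by
    intro h
    simp only [Set.mem_iUnion] at h
    obtain ⟨σ, h1, h2⟩ := h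
    exact h1.1 (hc σ h2)
  obtain ⟨m, hm, hmU⟩ := Metric.mem_nhds_iff.1 (hU.isOpen_compl.mem_nhds h0)
  refine (Set.finite_Iic ⌈B / m⌉₊).subset ?_
  rintro k ⟨τ, ⟨_, ⟨s, rfl⟩, hs⟩, h⟩
  obtain ⟨σ, h1, h2⟩ := exists_of_coeff_chainMap_pow_ne_zero k h
  rw [h2, iterate_timeOne_dilation] at hs
  have h3 := hB _ hs
  rw [norm_smul, Real.norm_of_nonneg (by positivity)] at h3
  have h4 : (1 : ℝ) ≤ 2 ^ k := one_le_pow₀ one_le_two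
  have h5 : ‖σ s‖ ≤ B := (le_mul_of_one_le_left (norm_nonneg _) h4).trans h3
  have h6 : m ≤ ‖σ s‖ := by
    by_contra! h7
    exact hmU (mem_ball_zero_iff.2 h7)
      (Set.mem_biUnion (show σ ∈ T from ⟨h1, σ s, ⟨s, rfl⟩, mem_closedBall_zero_iff.2 h5⟩)
        ⟨s, rfl⟩)
  have h7 : (k : ℝ) ≤ 2 ^ k := by exact_mod_cast Nat.lt_two_pow_self.le
  have h8 : (k : ℝ) ≤ B / m := by
    rw [le_div_iff₀ hm]
    exact (mul_le_mul h7 h6 hm.le (by positivity)).trans h3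
  exact_mod_cast h8.trans (Nat.le_ceil _)

/-- A locally finite cycle which avoids the origin bounds. -/
theorem exists_boundary_of_mem_avoiding {c : Chain R 1 V} (hc : c ∈ avoiding R 1 (0 : V))
    (h : boundary R 0 V c = 0) : ∃ b, boundary R 1 V b = c := by
  obtain ⟨b, e, he, hb⟩ := exists_boundary_of_locFin_iterate properHomotopy_dilation
    (fun x => by simp [dilation]) isProperMap_timeOne_dilation c (locFin_dilation hc)
  have he0 : e = 0 := by
    refine Chain.ext_coeff fun τ => ?_
    rw [map_zero]
    by_contra h1
    obtain ⟨k, hk⟩ := he τ h1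
    rw [h, map_zero, map_zero] at hk
    exact hk rfl
  refine ⟨-b, ?_⟩
  rw [he0, map_zero, add_zero] at hb
  rw [map_neg, hb, neg_neg]

/-- Two chains with opposite boundaries, one finite and one avoiding the origin, have a sum which
bounds, provided the boundary can be translated to infinity without meeting the origin. -/
theorem exists_boundary_add {c₁ c₂ : Chain R 1 V} (h₁ : {σ | coeff R σ c₁ ≠ 0}.Finite)
    (h₂ : c₂ ∈ avoiding R 1 (0 : V)) (h : boundary R 0 V (c₁ + c₂) = 0) {u : V} (hu : u ≠ 0)
    (hu' : ∀ x, coeff R (pt x) (boundary R 0 V c₁) ≠ 0 → ∀ l : ℝ, 0 ≤ l → x + l • u ≠ 0) :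
    ∃ b, boundary R 1 V b = c₁ + c₂ := by
  obtain ⟨b, e, he, hb⟩ := exists_boundary_of_locFin_iterate (properHomotopy_translation u)
    (fun x => by simp [translation]) (isProperMap_timeOne_translation u) c₁
    (locFin_translation hu h₁)
  set w := push _ (properHomotopy_translation u).trace e with hw
  have hw0 : w ∈ avoiding R 1 (0 : V) := by
    -- The simplices of `e` are points `x + k • u` with `x` in the boundary of `c₁`. Their traces
    -- therefore consist of points `x + l • u` with `l ≥ 0`, and these are nonzero by the choice of
    -- `u`.
    rintro τ ⟨s, hs⟩
    by_contra h1
    obtain ⟨ρ, rfl, h2⟩ := exists_of_coeff_push_ne_zero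
      (hg := (properHomotopy_translation u).trace) h1
    obtain ⟨k, hk⟩ := he ρ h2
    obtain ⟨π, h3, h4⟩ := exists_of_coeff_chainMap_pow_ne_zero k hk
    obtain ⟨x, rfl⟩ := exists_eq_pt π
    refine hu' x h3 (k + s.1 1) (add_nonneg k.cast_nonneg (s.2.1 1)) ?_
    have h5 : trace (translation u) ρ s = ρ (Classical.arbitrary _) + s.1 1 • u := by
      rw [trace, seg_apply]
      simp [translation]
    rw [hs, h4, iterate_timeOne_translation, add_assoc, ← add_smul] at h5
    exact h5.symm
  -- Modulo boundaries `c₁` may be replaced by `-w`, which avoids the origin. The sum `c₁ + c₂` then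
  -- becomes the cycle `c₂ - w`, to which the dilation argument applies.
  have e1 : c₁ = -w - boundary R 1 V b := by
    rw [← neg_eq_iff_eq_neg.2 hb]
    abel
  have e2 : boundary R 0 V (c₂ - w) = 0 := by
    rw [← h, e1]
    simp [boundary_boundary, sub_eq_neg_add]
  obtain ⟨b', hb'⟩ := exists_boundary_of_mem_avoiding (sub_mem h₂ hw0) e2
  refine ⟨b' - b, ?_⟩
  rw [map_sub, hb', e1]
  abel

end vectorSpace

/-- A ray from `x ≠ 0` can reach the origin only if its direction is parallel to `x`. It suffices to
take `(1, t)` with `t` different from the finitely many slopes of points of `S`; a vertical `x`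
forces `l = 0`, so the value of its slope is immaterial. -/
theorem exists_direction {S : Set (Fin 2 → ℝ)} (hS : S.Finite) (h0 : 0 ∉ S) :
    ∃ u : Fin 2 → ℝ, u ≠ 0 ∧ ∀ x ∈ S, ∀ l : ℝ, 0 ≤ l → x + l • u ≠ 0 := by
  obtain ⟨t, ht⟩ := (hS.image fun x => x 1 / x 0).exists_notMem
  refine ⟨![1, t], fun h => one_ne_zero (congrFun h 0), fun x hx l _ h => ?_⟩
  have e0 : x 0 + l * 1 = 0 := congrFun h 0
  have e1 : x 1 + l * t = 0 := congrFun h 1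
  by_cases hl : l = 0
  · subst hl
    refine h0 ?_
    convert hx
    rw [zero_smul, add_zero] at h
    exact h.symm
  · refine ht ⟨x, hx, ?_⟩
    change x 1 / x 0 = t
    rw [div_eq_iff (by intro h1; apply hl; linarith)]
    linear_combination e1 - t * e0

/-- Every locally finite `1`-cycle of the plane bounds. -/
theorem exists_boundary_plane {R : Type*} [CommRing R] {c : Chain R 1 (Fin 2 → ℝ)}
    (hc : boundary R 0 _ c = 0) : ∃ b, boundary R 1 (Fin 2 → ℝ) b = c := by
  have hT := c.2 {0} isCompact_singleton
  set c₁ : Chain R 1 (Fin 2 → ℝ) := ∑ σ ∈ hT.toFinset, coeff R σ c • single R σ with h₁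
  have hfin : {σ | coeff R σ c₁ ≠ 0}.Finite := finite_support_sum_single c _
  have h₂ : c - c₁ ∈ avoiding R 1 (0 : Fin 2 → ℝ) := by
    intro σ hσ
    change coeff R σ (c - c₁) = 0
    by_cases h : coeff R σ c = 0
    · rw [map_sub, h₁, sum_coeff_smul_single]
      simp [h]
    · have h3 : σ ∈ hT.toFinset := by
        rw [Set.Finite.mem_toFinset]
        exact ⟨h, 0, hσ, rfl⟩
      rw [map_sub, h₁, sum_coeff_smul_single, if_pos h3, sub_self]
  have hS : {x | coeff R (pt x) (boundary R 0 _ c₁) ≠ 0}.Finite := by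
    refine ((hfin.image fun σ => path σ 0).union (hfin.image fun σ => path σ 1)).subset ?_
    intro x hx
    obtain ⟨σ, i, h3, h4⟩ := exists_of_coeff_boundary_ne_zero hx
    fin_cases i
    · right
      exact ⟨σ, h4, pt_injective ((face_zero_eq σ).symm.trans h3)⟩
    · left
      exact ⟨σ, h4, pt_injective ((face_one_eq σ).symm.trans h3)⟩
  -- Since `c` is a cycle, the boundary of `c₁` is minus that of `c - c₁`, which avoids the origin.
  have h0 : (0 : Fin 2 → ℝ) ∉ {x | coeff R (pt x) (boundary R 0 _ c₁) ≠ 0} := by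
    simp only [Set.mem_ofPred_eq, not_not]
    have h3 : coeff R (pt 0) (boundary R 0 _ (c - c₁)) = 0 :=
      boundary_mem_avoiding h₂ (pt 0) (by rw [range_pt]; rfl)
    rw [map_sub, hc, zero_sub, map_neg, neg_eq_zero] at h3
    exact h3
  obtain ⟨u, hu, hu'⟩ := exists_direction hS h0
  obtain ⟨b, hb⟩ := exists_boundary_add hfin h₂ (by rwa [add_sub_cancel]) hu hu'
  exact ⟨b, by rw [hb, add_sub_cancel]⟩

/-! ### Local homology at a point with an arc neighbourhood -/

section localClass

variable {R : Type*} [CommRing R] {X : Type*} [TopologicalSpace X] {p : X}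

/-- The class of a `1`-chain modulo boundaries and chains avoiding `p`. -/
def relClass (R : Type*) [CommRing R] {X : Type*} [TopologicalSpace X] (p : X) :
    Chain R 1 X →ₗ[R] Chain R 1 X ⧸ relBoundaries R p 1 :=
  (relBoundaries R p 1).mkQ

/-- The class of a `1`-simplex modulo boundaries and chains avoiding `p`. -/
def simplexClass (R : Type*) [CommRing R] {X : Type*} [TopologicalSpace X] (p : X)
    (σ : Simplex 1 X) : Chain R 1 X ⧸ relBoundaries R p 1 :=
  relClass R p (single R σ)

theorem relClass_boundary (b : Chain R 2 X) : relClass R p (boundary R 1 X b) = 0 :=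
  (Submodule.Quotient.mk_eq_zero _).2 (Submodule.mem_sup_left ⟨b, rfl⟩)

theorem relClass_of_mem_avoiding {c : Chain R 1 X} (hc : c ∈ avoiding R 1 p) :
    relClass R p c = 0 :=
  (Submodule.Quotient.mk_eq_zero _).2 (Submodule.mem_sup_right hc)

theorem simplexClass_of_notMem {σ : Simplex 1 X} (h : p ∉ Set.range σ) :
    simplexClass R p σ = 0 := by
  refine relClass_of_mem_avoiding fun τ hτ => ?_
  exact coeff_single_of_ne (by rintro rfl; exact h hτ)

section

variable {V : Type*} [AddCommGroup V] [Module ℝ V] [TopologicalSpace V] [IsTopologicalAddGroup V]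
  [ContinuousSMul ℝ V]

/-- The difference of the two sides is the boundary of the triangle on `a`, `b`, `c`. -/
theorem simplexClass_seg_add (g : C(V, X)) (a b c : V) :
    simplexClass R p (seg g a b) + simplexClass R p (seg g b c) =
      simplexClass R p (seg g a c) := by
  have h := relClass_boundary (R := R) (p := p) (single R (tri g a b c))
  rw [boundary_tri, map_add, map_sub] at h
  simp only [simplexClass]
  rw [← sub_eq_zero, ← h]
  abel

theorem simplexClass_seg_self (g : C(V, X)) (a : V) : simplexClass R p (seg g a a) = 0 := by
  simpa using simplexClass_seg_add (R := R) (p := p) g a a a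

end

/-- The class of a path that lifts to `ℝ` along `γ` is determined by the ends of the lift. -/
theorem simplexClass_eq_of_lift (γ : C(ℝ, X)) (σ : Simplex 1 X) (l : C(ℝ, ℝ))
    (h : ∀ t, γ (l t) = path σ t) (q : ℝ) :
    simplexClass R p σ =
      simplexClass R p (seg γ q (l 1)) - simplexClass R p (seg γ q (l 0)) := by
  -- The lift is contracted linearly to `q`. In the resulting square one side is constant, the
  -- opposite one is `σ`, and the other two are arcs of `γ` from `q` to the ends of the lift; the
  -- two triangles on the diagonal compare them.
  let H : C(ℝ × ℝ, X) := γ.comp ⟨fun x => (1 - x.1) * q + x.1 * l x.2, by fun_prop⟩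
  have hH : ∀ x : ℝ × ℝ, H x = γ ((1 - x.1) * q + x.1 * l x.2) := fun _ => rfl
  have h1 := simplexClass_seg_add (R := R) (p := p) H (0, 0) (1, 0) (1, 1)
  have h2 := simplexClass_seg_add (R := R) (p := p) H (0, 0) (0, 1) (1, 1)
  have hs : ∀ s : stdSimplex ℝ (Fin 2), s.1 0 = 1 - s.1 1 := fun s =>
    eq_sub_of_add_eq (stdSimplex.add_eq_one s)
  have e1 : seg H (1, 0) (1, 1) = σ := by
    rw [← seg_path σ]
    ext s
    rw [seg_apply, seg_apply, hH, ← h]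
    simp [hs]
  have e2 : seg H (0, 0) (1, 0) = seg γ q (l 0) := by
    ext s
    rw [seg_apply, seg_apply, hH]
    simp [hs]
  have e3 : seg H (0, 1) (1, 1) = seg γ q (l 1) := by
    ext s
    rw [seg_apply, seg_apply, hH]
    simp [hs]
  have e4 : seg H (0, 0) (0, 1) = seg γ q q := by
    ext s
    rw [seg_apply, seg_apply, hH]
    simp [hs, ← add_mul]
  rw [e1, e2] at h1
  rw [e3, e4, simplexClass_seg_self, zero_add] at h2
  rw [h2, ← h1]
  abel

theorem simplexClass_seg_of_forall_ne {γ : C(ℝ, X)} {a b : ℝ}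
    (h : ∀ t ∈ Set.uIcc a b, γ t ≠ p) : simplexClass R p (seg γ a b) = 0 := by
  refine simplexClass_of_notMem ?_
  rw [range_seg]
  rintro ⟨t, ht, h1⟩
  exact h t ht h1

/-- The class of a short arc through `p` only depends on which sides of `p` its ends lie on. -/
theorem simplexClass_seg_eq {γ : C(ℝ, X)} {ε : ℝ}
    (h : ∀ t, |t| < ε → γ t = p → t = 0) {a b a' b' : ℝ} (ha : a < 0) (ha' : a' < 0) (hb : 0 < b)
    (hb' : 0 < b') (h₁ : -ε < a) (h₂ : -ε < a') (h₃ : b < ε) (h₄ : b' < ε) :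
    simplexClass R p (seg γ a b) = simplexClass R p (seg γ a' b') := by
  rw [← simplexClass_seg_add γ a a' b, ← simplexClass_seg_add γ a' b' b,
    simplexClass_seg_of_forall_ne (a := a) (b := a'),
    simplexClass_seg_of_forall_ne (a := b') (b := b), zero_add, add_zero]
  · rintro t ⟨h5, h6⟩ h7
    have := lt_inf_iff.2 ⟨hb', hb⟩
    have := sup_lt_iff.2 ⟨h₄, h₃⟩
    linarith [h t (abs_lt.2 ⟨by linarith, by linarith⟩) h7]
  · rintro t ⟨h5, h6⟩ h7
    have := lt_inf_iff.2 ⟨h₁, h₂⟩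
    have := sup_lt_iff.2 ⟨ha, ha'⟩
    linarith [h t (abs_lt.2 ⟨by linarith, by linarith⟩) h7]

variable {γ : C(ℝ, X)} {ε δ : ℝ}

/-- In an arc neighbourhood of `p`, or away from `p`, the class of a path is a multiple of the class
of the arc, up to a correction at the ends of the path which pass through `p`. -/
theorem simplexClass_mem_of_subset (hδ : 0 < δ) (hδε : δ < ε) (h0 : γ 0 = p)
    (hγ : Topology.IsOpenEmbedding fun t : Set.Ioo (-ε) ε => γ t) [DecidableEq X]
    (σ : Simplex 1 X) (hσ : Set.range σ ⊆ γ '' Set.Ioo (-ε) ε) :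
    simplexClass R p σ - ((if path σ 1 = p then simplexClass R p (seg γ (-δ) 0) else 0) -
      (if path σ 0 = p then simplexClass R p (seg γ (-δ) 0) else 0)) ∈
      Submodule.span R {simplexClass R p (seg γ (-δ) δ)} := by
  have hε := hδ.trans hδε
  have hinj : ∀ t, |t| < ε → γ t = p → t = 0 := by
    intro t ht h
    have h1 := hγ.injective (a₁ := ⟨t, abs_lt.1 ht⟩) (a₂ := ⟨0, by simpa using hε⟩)
      (h.trans h0.symm)
    exact congrArg Subtype.val h1
  choose l hl hl' using fun t => hσ (path_mem_range σ t)
  have hlc : Continuous l := by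
    have h1 : Continuous fun t => (⟨l t, hl t⟩ : Set.Ioo (-ε) ε) := by
      rw [hγ.isEmbedding.continuous_iff]
      exact (path σ).continuous.congr fun t => (hl' t).symm
    exact continuous_subtype_val.comp h1
  have key : ∀ t, simplexClass R p (seg γ (-δ) (l t)) -
      (if path σ t = p then simplexClass R p (seg γ (-δ) 0) else 0) ∈
        Submodule.span R {simplexClass R p (seg γ (-δ) δ)} := by
    intro t
    obtain ⟨h1, h2⟩ := hl t
    -- The arc from `-δ` to `l t` misses `p` if it ends before `0`, is the half arc used as
    -- correction if it ends at `0`, and has the class of the full arc if it ends beyond.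
    rcases lt_trichotomy (l t) 0 with h | h | h
    · have h3 : path σ t ≠ p := fun h4 =>
        h.ne (hinj _ (abs_lt.2 ⟨h1, h2⟩) ((hl' t).trans h4))
      rw [if_neg h3, sub_zero, simplexClass_seg_of_forall_ne (a := -δ) (b := l t)]
      · exact zero_mem _
      · rintro r ⟨h5, h6⟩ h7
        have := lt_inf_iff.2 ⟨neg_lt_neg hδε, h1⟩
        have := sup_lt_iff.2 ⟨neg_lt_zero.2 hδ, h⟩
        linarith [hinj r (abs_lt.2 ⟨by linarith, by linarith⟩) h7]
    · rw [if_pos (by rw [← hl', h, h0]), h, sub_self]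
      exact zero_mem _
    · have h3 : path σ t ≠ p := fun h4 =>
        h.ne' (hinj _ (abs_lt.2 ⟨h1, h2⟩) ((hl' t).trans h4))
      rw [if_neg h3, sub_zero, simplexClass_seg_eq hinj (neg_lt_zero.2 hδ) (neg_lt_zero.2 hδ) h hδ
        (neg_lt_neg hδε) (neg_lt_neg hδε) h2 hδε]
      exact Submodule.mem_span_singleton_self _
  rw [simplexClass_eq_of_lift γ σ ⟨l, hlc⟩ hl' (-δ)]
  convert! sub_mem (key 1) (key 0) using 1
  simp only [ContinuousMap.coe_mk]
  abel

variable [T1Space X]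

/-- A path is subdivided into pieces that either miss `p` or lie in the arc neighbourhood. The end
corrections telescope, so division points at `p` do no harm. -/
theorem simplexClass_mem (hδ : 0 < δ) (hδε : δ < ε) (h0 : γ 0 = p)
    (hγ : Topology.IsOpenEmbedding fun t : Set.Ioo (-ε) ε => γ t) [DecidableEq X]
    (σ : Simplex 1 X) :
    simplexClass R p σ - ((if path σ 1 = p then simplexClass R p (seg γ (-δ) 0) else 0) -
      (if path σ 0 = p then simplexClass R p (seg γ (-δ) 0) else 0)) ∈
      Submodule.span R {simplexClass R p (seg γ (-δ) δ)} := by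
  have hε := hδ.trans hδε
  have hUr : γ '' Set.Ioo (-ε) ε = Set.range fun t : Set.Ioo (-ε) ε => γ t := by
    rw [Set.image_eq_range]
  have hU : IsOpen (γ '' Set.Ioo (-ε) ε) := by
    rw [hUr]
    exact hγ.isOpen_range
  let c : Bool → Set (Set.Icc (0 : ℝ) 1) := fun i =>
    (fun t => path σ t) ⁻¹' (if i then γ '' Set.Ioo (-ε) ε else {p}ᶜ)
  have hcont : Continuous fun t : Set.Icc (0 : ℝ) 1 => path σ t := by fun_prop
  obtain ⟨t, ht0, htm, ⟨N, hN⟩, ht⟩ := exists_monotone_Icc_subset_open_cover_Icc (c := c)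
    zero_le_one (by
      intro i
      refine IsOpen.preimage hcont ?_
      cases i
      · exact isOpen_compl_singleton
      · exact hU) (by
      intro t _
      rw [Set.mem_iUnion]
      by_cases h : path σ t = p
      · exact ⟨true, show path σ t ∈ γ '' Set.Ioo (-ε) ε from
          ⟨0, by simpa using hε, h0.trans h.symm⟩⟩
      · exact ⟨false, h⟩)
  have key : ∀ n, simplexClass R p (seg (path σ) 0 (t n)) -
      ((if path σ (t n) = p then simplexClass R p (seg γ (-δ) 0) else 0) -
        (if path σ 0 = p then simplexClass R p (seg γ (-δ) 0) else 0)) ∈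
      Submodule.span R {simplexClass R p (seg γ (-δ) δ)} := by
    intro n
    induction n with
    | zero =>
      rw [ht0, simplexClass_seg_self, sub_self, sub_zero]
      exact zero_mem _
    | succ n ih =>
      have hle : (t n : ℝ) ≤ t (n + 1) := htm n.le_succ
      set τ := seg (path σ) (t n : ℝ) (t (n + 1)) with hτ
      have hτr : Set.range τ = path σ '' Set.Icc (t n : ℝ) (t (n + 1)) := by
        rw [hτ, range_seg, Set.uIcc_of_le hle]
      have hτ0 : path τ 0 = path σ (t n) := pt_injective (by
        rw [← face_one_eq, hτ, face_one_seg])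
      have hτ1 : path τ 1 = path σ (t (n + 1)) := pt_injective (by
        rw [← face_zero_eq, hτ, face_zero_seg])
      have hstep : simplexClass R p τ -
          ((if path τ 1 = p then simplexClass R p (seg γ (-δ) 0) else 0) -
            (if path τ 0 = p then simplexClass R p (seg γ (-δ) 0) else 0)) ∈
          Submodule.span R {simplexClass R p (seg γ (-δ) δ)} := by
        obtain ⟨i, hi⟩ := ht n
        have hi' : ∀ r, r ∈ Set.Icc (t n : ℝ) (t (n + 1)) →
            path σ r ∈ if i then γ '' Set.Ioo (-ε) ε else {p}ᶜ := fun r hr =>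
          hi (show (⟨r, (t n).2.1.trans hr.1, hr.2.trans (t (n + 1)).2.2⟩ : Set.Icc (0 : ℝ) 1) ∈
            Set.Icc (t n) (t (n + 1)) from hr)
        cases i
        · have h1 : ∀ x ∈ Set.range τ, x ≠ p := by
            rw [hτr]
            rintro _ ⟨r, hr, rfl⟩
            exact hi' r hr
          rw [simplexClass_of_notMem fun h => h1 p h rfl, if_neg (h1 _ (path_mem_range τ 1)),
            if_neg (h1 _ (path_mem_range τ 0)), sub_self, sub_self]
          exact zero_mem _
        · refine simplexClass_mem_of_subset hδ hδε h0 hγ τ ?_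
          rw [hτr]
          rintro _ ⟨r, hr, rfl⟩
          exact hi' r hr
      rw [hτ0, hτ1] at hstep
      convert! add_mem ih hstep using 1
      rw [← simplexClass_seg_add (path σ) (0 : ℝ) (t n) (t (n + 1))]
      abel
  have h1 := key N
  rwa [hN N le_rfl, seg_path] at h1

/-- Near a point with an arc neighbourhood, the arc generates the local homology. -/
theorem relClass_mem_span (hδ : 0 < δ) (hδε : δ < ε) (h0 : γ 0 = p)
    (hγ : Topology.IsOpenEmbedding fun t : Set.Ioo (-ε) ε => γ t)
    {z : Chain R 1 X} (hz : z ∈ relCycles R p 1) :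
    relClass R p z ∈ Submodule.span R {simplexClass R p (seg γ (-δ) δ)} := by
  classical
  have hT := z.2 {p} isCompact_singleton
  set z₁ : Chain R 1 X := ∑ σ ∈ hT.toFinset, coeff R σ z • single R σ with h₁
  have h₂ : z - z₁ ∈ avoiding R 1 p := by
    intro σ hσ
    change coeff R σ (z - z₁) = 0
    by_cases h : coeff R σ z = 0
    · rw [map_sub, h₁, sum_coeff_smul_single]
      simp [h]
    · have h3 : σ ∈ hT.toFinset := by
        rw [Set.Finite.mem_toFinset]
        exact ⟨h, p, hσ, rfl⟩
      rw [map_sub, h₁, sum_coeff_smul_single, if_pos h3, sub_self]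
  have hp : p ∈ Set.range (pt p) := by rw [range_pt]; rfl
  have h3 : coeff R (pt p) (boundary R 0 X z₁) = 0 := by
    have h4 : coeff R (pt p) (boundary R 0 X (z - z₁)) = 0 := boundary_mem_avoiding h₂ _ hp
    have h5 : coeff R (pt p) (boundary R 0 X z) = 0 := hz _ hp
    rwa [map_sub, map_sub, h5, zero_sub, neg_eq_zero] at h4
  have h4 : ∀ x : X, coeff R (pt p) (single R (pt x)) = if x = p then 1 else 0 := by
    intro x
    split_ifs with h
    · rw [h, coeff_single_self]
    · exact coeff_single_of_ne fun h5 => h (pt_injective h5).symm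
  have h5 : relClass R p z = ∑ σ ∈ hT.toFinset, coeff R σ z • (simplexClass R p σ -
      ((if path σ 1 = p then simplexClass R p (seg γ (-δ) 0) else 0) -
      (if path σ 0 = p then simplexClass R p (seg γ (-δ) 0) else 0))) := by
    have h6 : relClass R p z = relClass R p z₁ := by
      rw [← sub_eq_zero, ← map_sub, relClass_of_mem_avoiding h₂]
    -- The corrections add up to the half arc times the coefficient of `p` in the boundary of `z₁`,
    -- which vanishes for a relative cycle.
    have h7 : ∑ σ ∈ hT.toFinset, coeff R σ z •
        ((if path σ 1 = p then simplexClass R p (seg γ (-δ) 0) else 0) -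
        (if path σ 0 = p then simplexClass R p (seg γ (-δ) 0) else 0)) =
        coeff R (pt p) (boundary R 0 X z₁) • simplexClass R p (seg γ (-δ) 0) := by
      simp only [h₁, map_sum, map_smul, boundary_single, face_zero_eq, face_one_eq, map_sub, h4,
        Finset.sum_smul, smul_eq_mul, mul_smul, sub_smul, ite_smul, one_smul, zero_smul]
    simp only [smul_sub, Finset.sum_sub_distrib] at h7 ⊢
    rw [h7, h3, zero_smul, sub_zero, h6, h₁, map_sum]
    simp only [map_smul]
    rfl
  rw [h5]
  exact sum_mem fun σ _ => Submodule.smul_mem _ _ (simplexClass_mem hδ hδε h0 hγ σ)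

end localClass

/-! ### Étale flows: division of orbits into arcs and the fundamental cycle -/

/-- A flow on a space all of whose orbit maps are local homeomorphisms. -/
structure EtaleFlow (M : Type*) [TopologicalSpace M] where
  toFun : M → C(ℝ, M)
  map_zero : ∀ x, toFun x 0 = x
  map_add : ∀ x s t, toFun x (s + t) = toFun (toFun x s) t
  image_mem_nhds : ∀ x ε, 0 < ε → toFun x '' Set.Ioo (-ε) ε ∈ nhds x
  exists_injOn : ∀ x, ∃ ε > 0, Set.InjOn (toFun x) (Set.Ioo (-ε) ε)

namespace EtaleFlow

variable {M : Type*} [TopologicalSpace M] (Φ : EtaleFlow M)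

theorem isOpenMap (x : M) : IsOpenMap (Φ.toFun x) := by
  intro U hU
  rw [isOpen_iff_mem_nhds]
  rintro _ ⟨t, ht, rfl⟩
  obtain ⟨ε, hε, h⟩ := Metric.isOpen_iff.1 hU t ht
  refine Filter.mem_of_superset (Φ.image_mem_nhds (Φ.toFun x t) ε hε) ?_
  rintro _ ⟨r, hr, rfl⟩
  refine ⟨t + r, h ?_, Φ.map_add x t r⟩
  rw [Metric.mem_ball, dist_self_add_left]
  exact abs_lt.2 hr

theorem exists_isOpenEmbedding (x : M) : ∃ ε : ℝ, 0 < ε ∧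
    Topology.IsOpenEmbedding fun t : Set.Ioo (-ε) ε => Φ.toFun x t := by
  obtain ⟨ε, hε, h⟩ := Φ.exists_injOn x
  refine ⟨ε, hε, Topology.IsOpenEmbedding.of_continuous_injective_isOpenMap (by fun_prop)
    (fun s t hst => Subtype.ext (h s.2 t.2 hst)) ?_⟩
  exact (Φ.isOpenMap x).comp (isOpen_Ioo.isOpenMap_subtype_val)

theorem toFun_neg (x : M) (t : ℝ) : Φ.toFun (Φ.toFun x t) (-t) = x := by
  rw [← Φ.map_add, add_neg_cancel, Φ.map_zero]

theorem toFun_eq_iff {x : M} {s t : ℝ} : Φ.toFun x s = Φ.toFun x t ↔ Φ.toFun x (s - t) = x := by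
  constructor
  · intro h
    rw [sub_eq_add_neg, Φ.map_add, h, Φ.toFun_neg]
  · intro h
    conv_rhs => rw [← h]
    rw [← Φ.map_add, sub_add_cancel]

theorem toFun_toFun_eq_iff {x : M} {s t : ℝ} :
    Φ.toFun (Φ.toFun x s) t = Φ.toFun x s ↔ Φ.toFun x t = x := by
  rw [← Φ.map_add, Φ.toFun_eq_iff, add_sub_cancel_left]

/-- The periods of a point. -/
def periods (x : M) : AddSubgroup ℝ where
  carrier := {t | Φ.toFun x t = x}
  zero_mem' := Φ.map_zero x
  add_mem' := by
    intro s t hs ht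
    change Φ.toFun x (s + t) = x
    rw [Φ.map_add, show Φ.toFun x s = x from hs]
    exact ht
  neg_mem' := by
    intro t ht
    have h := Φ.toFun_neg x t
    rwa [show Φ.toFun x t = x from ht] at h

theorem mem_periods {x : M} {t : ℝ} : t ∈ Φ.periods x ↔ Φ.toFun x t = x := Iff.rfl

/-- Local injectivity makes the periods a discrete subgroup of `ℝ`, hence generated by some `T`. On
a closed orbit the step is half the period, giving two arcs, so that an arc never closes up and
consecutive division points differ. If `T = 0` any step serves, and `1` is taken. -/
theorem exists_step (x : M) : ∃ s > 0, (∀ t ∈ Φ.periods x, ∃ k : ℤ, t = k * s) ∧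
    ∀ t ∈ Φ.periods x, |t| < 2 * s → t = 0 := by
  obtain ⟨ε, hε, h⟩ := Φ.exists_injOn x
  have hd : Disjoint (Φ.periods x : Set ℝ) (Set.Ioo 0 ε) := by
    rw [Set.disjoint_left]
    intro t ht h1
    exact h1.1.ne' (h ⟨by linarith [h1.1], h1.2⟩ ⟨by linarith, hε⟩ (ht.trans (Φ.map_zero x).symm))
  obtain ⟨T, hT⟩ := AddSubgroup.cyclic_of_isolated_zero hε hd
  by_cases h0 : T = 0
  · refine ⟨1, one_pos, ?_, ?_⟩
    · intro t ht
      rw [hT, h0, AddSubgroup.mem_closure_singleton] at ht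
      obtain ⟨k, rfl⟩ := ht
      exact ⟨0, by simp⟩
    · intro t ht _
      rw [hT, h0, AddSubgroup.mem_closure_singleton] at ht
      obtain ⟨k, rfl⟩ := ht
      simp
  · refine ⟨|T| / 2, by positivity, ?_, ?_⟩
    · intro t ht
      rw [hT, AddSubgroup.mem_closure_singleton] at ht
      obtain ⟨k, rfl⟩ := ht
      rcases abs_choice T with h1 | h1
      · exact ⟨2 * k, by rw [h1]; push_cast; rw [zsmul_eq_mul]; ring⟩
      · exact ⟨-(2 * k), by rw [h1]; push_cast; rw [zsmul_eq_mul]; ring⟩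
    · intro t ht h2
      rw [hT, AddSubgroup.mem_closure_singleton] at ht
      obtain ⟨k, rfl⟩ := ht
      rw [zsmul_eq_mul, abs_mul, mul_div_cancel₀ _ (two_ne_zero' ℝ)] at h2
      have h3 : |(k : ℝ)| < 1 := by
        by_contra! h4
        exact absurd h2 (not_lt.2 (le_mul_of_one_le_left (abs_nonneg T) h4))
      have h4 : k = 0 := by
        rw [← Int.abs_lt_one_iff]
        exact_mod_cast h3
      simp [h4]

/-- The partition into orbits. -/
def orbitSetoid : Setoid M where
  r x y := ∃ t, Φ.toFun x t = y
  iseqv :=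
    { refl := fun x => ⟨0, Φ.map_zero x⟩
      symm := by
        rintro x _ ⟨t, rfl⟩
        exact ⟨-t, Φ.toFun_neg x t⟩
      trans := by
        rintro x _ _ ⟨s, rfl⟩ ⟨t, rfl⟩
        exact ⟨s + t, Φ.map_add x s t⟩ }

/-- A chosen point on the orbit of `x`. -/
def base (x : M) : M := (Quotient.mk Φ.orbitSetoid x).out

theorem exists_base (x : M) : ∃ t, Φ.toFun (Φ.base x) t = x :=
  Quotient.exact (s := Φ.orbitSetoid) (Quotient.out_eq _)

theorem base_toFun (x : M) (t : ℝ) : Φ.base (Φ.toFun x t) = Φ.base x :=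
  congrArg Quotient.out (Quotient.sound (s := Φ.orbitSetoid) ⟨-t, Φ.toFun_neg x t⟩)

theorem base_base (x : M) : Φ.base (Φ.base x) = Φ.base x := by
  obtain ⟨t, ht⟩ := Φ.exists_base x
  rw [← Φ.base_toFun (Φ.base x) t, ht]

/-- A length into which the orbit of `x` can be divided, shorter than a period. -/
def step (x : M) : ℝ := (Φ.exists_step (Φ.base x)).choose

theorem step_toFun (x : M) (t : ℝ) : Φ.step (Φ.toFun x t) = Φ.step x := by
  simp only [step, base_toFun]

theorem step_base (x : M) : Φ.step (Φ.base x) = Φ.step x := by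
  obtain ⟨t, ht⟩ := Φ.exists_base x
  conv_rhs => rw [← ht]
  rw [step_toFun]

theorem step_pos (x : M) : 0 < Φ.step x := (Φ.exists_step (Φ.base x)).choose_spec.1

theorem periods_base (x : M) : Φ.periods (Φ.base x) = Φ.periods x := by
  obtain ⟨t, ht⟩ := Φ.exists_base x
  ext s
  rw [mem_periods, mem_periods, ← Φ.toFun_toFun_eq_iff (s := t), ht]

theorem exists_eq_mul_step {x : M} {t : ℝ} (ht : Φ.toFun x t = x) :
    ∃ k : ℤ, t = k * Φ.step x := by
  rw [← mem_periods, ← periods_base] at ht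
  exact (Φ.exists_step (Φ.base x)).choose_spec.2.1 t ht

theorem eq_zero_of_toFun_eq {x : M} {t : ℝ} (ht : Φ.toFun x t = x) (h : |t| < 2 * Φ.step x) :
    t = 0 := by
  rw [← mem_periods, ← periods_base] at ht
  exact (Φ.exists_step (Φ.base x)).choose_spec.2.2 t ht h

/-- The division points of all orbits. -/
def vertices : Set M := {v | ∃ k : ℤ, v = Φ.toFun (Φ.base v) (k * Φ.step v)}

theorem toFun_mem_vertices {v : M} (hv : v ∈ Φ.vertices) (k : ℤ) :
    Φ.toFun v (k * Φ.step v) ∈ Φ.vertices := by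
  obtain ⟨j, hj⟩ := hv
  refine ⟨j + k, ?_⟩
  rw [base_toFun, step_toFun]
  conv_lhs => rw [hj]
  rw [step_toFun, ← Φ.map_add]
  congr 1
  have h := Φ.step_base v
  push_cast
  rw [h]
  ring

/-- Two times at which the orbit of the base point reaches the same point differ by a period, and
periods are multiples of the step. -/
theorem exists_of_toFun_mem_vertices {v : M} (hv : v ∈ Φ.vertices) {t : ℝ}
    (ht : Φ.toFun v t ∈ Φ.vertices) : ∃ k : ℤ, t = k * Φ.step v := by
  obtain ⟨j, hj⟩ := hv
  obtain ⟨i, hi⟩ := ht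
  have h := Φ.step_base v
  rw [base_toFun, step_toFun] at hi
  have h1 : Φ.toFun (Φ.base v) (j * Φ.step v + t) = Φ.toFun (Φ.base v) (i * Φ.step v) := by
    rw [Φ.map_add, ← hj, hi]
  rw [toFun_eq_iff] at h1
  obtain ⟨k, hk⟩ := Φ.exists_eq_mul_step h1
  refine ⟨k + i - j, ?_⟩
  rw [h] at hk
  push_cast
  linear_combination hk

theorem exists_mem_vertices (x : M) :
    ∃ v ∈ Φ.vertices, ∃ u, 0 ≤ u ∧ u < Φ.step x ∧ Φ.toFun v u = x := by
  obtain ⟨t, ht⟩ := Φ.exists_base x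
  have hs := Φ.step_pos x
  have h := Φ.step_base x
  have hb : Φ.base x ∈ Φ.vertices := ⟨0, by rw [base_base, Int.cast_zero, zero_mul, Φ.map_zero]⟩
  have h1 := Φ.toFun_mem_vertices hb ⌊t / Φ.step x⌋
  rw [h] at h1
  refine ⟨_, h1, t - ⌊t / Φ.step x⌋ * Φ.step x, ?_, ?_, ?_⟩
  · rw [sub_nonneg, ← le_div_iff₀ hs]
    exact Int.floor_le _
  · have h2 := Int.lt_floor_add_one (t / Φ.step x)
    rw [div_lt_iff₀ hs] at h2
    linarith
  · rw [← Φ.map_add, add_sub_cancel, ht]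

/-- The arc of the flow from a point `v` to the point one step further. -/
def edge (v : M) : Simplex 1 M := seg (Φ.toFun v) (0 : ℝ) (Φ.step v)

theorem mem_range_edge {v x : M} :
    x ∈ Set.range (Φ.edge v) ↔ ∃ u, 0 ≤ u ∧ u ≤ Φ.step v ∧ Φ.toFun v u = x := by
  rw [edge, range_seg, Set.uIcc_of_le (Φ.step_pos v).le]
  simp [and_assoc]

theorem finite_edges_near (x : M) : ∃ N ∈ nhds x,
    {v : Φ.vertices | (Set.range (Φ.edge v) ∩ N).Nonempty}.Finite := by
  refine ⟨_, Φ.image_mem_nhds x 1 one_pos, Set.Finite.of_finite_image (f := Subtype.val) ?_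
    Subtype.val_injective.injOn⟩
  obtain ⟨w, hw, u₀, hu₀, hu₀', hx⟩ := Φ.exists_mem_vertices x
  set s := Φ.step x with hs
  have hs0 : 0 < s := Φ.step_pos x
  have hws : Φ.step w = s := by rw [hs, ← hx, step_toFun]
  refine ((Set.finite_Icc (-⌈1 / s + 1⌉) ⌈1 / s + 1⌉).image fun k : ℤ =>
    Φ.toFun w (k * s)).subset ?_
  rintro _ ⟨v, ⟨y, h1, ⟨r, ⟨hr, hr'⟩, hy⟩⟩, rfl⟩
  obtain ⟨u, hu, hu', h2⟩ := Φ.mem_range_edge.1 h1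
  -- The time from `w` to `v` is a multiple `k * s`. Since `|r| < 1` and `u₀`, `u` lie in `[0, s]`,
  -- it follows that `|k| ≤ 1 / s + 1`.
  have h3 : (v : M) = Φ.toFun w (u₀ + r - u) := by
    rw [← Φ.toFun_neg v u, h2, ← hy, ← hx, ← Φ.map_add, ← Φ.map_add, ← sub_eq_add_neg,
      add_sub_assoc]
  have h4 : Φ.step v = s := by rw [h3, step_toFun, hws]
  obtain ⟨k, hk⟩ := Φ.exists_of_toFun_mem_vertices hw (h3 ▸ v.2)
  rw [hws] at hk
  refine ⟨k, ?_, by rw [h3, hk]⟩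
  rw [h4] at hu'
  have h5 := Int.le_ceil (1 / s + 1)
  have h6 : 1 / s * s = 1 := by field_simp
  constructor
  · have h7 : -(1 / s + 1) ≤ k := by
      refine le_of_mul_le_mul_right ?_ hs0
      rw [← hk, neg_mul, add_mul, h6]
      linarith
    have h8 : -(⌈1 / s + 1⌉ : ℝ) ≤ k := by linarith
    exact_mod_cast h8
  · have h7 : k ≤ 1 / s + 1 := by
      refine le_of_mul_le_mul_right ?_ hs0
      rw [← hk, add_mul, h6]
      linarith
    exact_mod_cast h7.trans h5

variable (R : Type*) [CommRing R]

theorem locFin_edges : LocFin fun v : Φ.vertices => single R (Φ.edge v) := by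
  intro K hK
  choose N hN hfin using Φ.finite_edges_near
  obtain ⟨t, _, ht⟩ := hK.elim_nhds_subcover N fun x _ => hN x
  refine (t.finite_toSet.biUnion fun x _ => hfin x).subset ?_
  rintro v ⟨σ, ⟨y, hy, hyK⟩, h⟩
  have h1 : σ = Φ.edge v := by
    by_contra h2
    exact h (coeff_single_of_ne h2)
  subst h1
  obtain ⟨x, hx, hyx⟩ := Set.mem_iUnion₂.1 (ht hyK)
  exact Set.mem_biUnion hx ⟨y, hy, hyx⟩

/-- The sum of all arcs between consecutive division points. -/
def fundamentalChain : Chain R 1 M := lfSum _ (Φ.locFin_edges R)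

/-- The successor on division points. -/
def next : Φ.vertices ≃ Φ.vertices where
  toFun v := ⟨Φ.toFun v (Φ.step v), by simpa using Φ.toFun_mem_vertices v.2 1⟩
  invFun v := ⟨Φ.toFun v (-Φ.step v), by simpa using Φ.toFun_mem_vertices v.2 (-1)⟩
  left_inv v := Subtype.ext (by
    change Φ.toFun (Φ.toFun _ _) (-Φ.step (Φ.toFun _ _)) = _
    rw [step_toFun, toFun_neg])
  right_inv v := Subtype.ext (by
    change Φ.toFun (Φ.toFun _ _) (Φ.step (Φ.toFun _ _)) = _
    rw [step_toFun, ← Φ.map_add, neg_add_cancel, Φ.map_zero])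

/-- The final points of the arcs are again all the division points, each counted once, because
`next` is a bijection. They cancel the initial points. -/
theorem boundary_fundamentalChain : boundary R 0 M (Φ.fundamentalChain R) = 0 := by
  rw [fundamentalChain, map_lfSum _ _ isLocal_boundary]
  refine Chain.ext_coeff fun τ => ?_
  obtain ⟨x, rfl⟩ := exists_eq_pt τ
  have hF : ∀ v : Φ.vertices, coeff R (pt x) (boundary R 0 M (single R (Φ.edge v))) =
      coeff R (pt x) (single R (pt (Φ.next v : M))) - coeff R (pt x) (single R (pt (v : M))) := by
    intro v
    rw [boundary_single, edge, face_zero_seg, face_one_seg, Φ.map_zero, map_sub]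
    rfl
  have hfin : (Function.support fun v : Φ.vertices =>
      coeff R (pt x) (single R (pt (v : M)))).Finite := by
    refine Set.Subsingleton.finite fun v hv w hw => Subtype.ext ?_
    have h : ∀ v : Φ.vertices, coeff R (pt x) (single R (pt (v : M))) ≠ 0 → (v : M) = x := by
      intro v hv
      by_contra h
      exact hv (coeff_single_of_ne fun h1 => h (pt_injective h1).symm)
    rw [h v hv, h w hw]
  have hfin' : (Function.support fun v : Φ.vertices =>
      coeff R (pt x) (single R (pt (Φ.next v : M)))).Finite :=
    hfin.preimage Φ.next.injective.injOn
  rw [coeff_lfSum, finsum_congr hF, finsum_sub_distrib hfin' hfin,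
    finsum_comp_equiv Φ.next (f := fun v : Φ.vertices => coeff R (pt x) (single R (pt (v : M)))),
    sub_self, LinearMap.map_zero]

theorem relClass_lfSum {ι X : Type*} [TopologicalSpace X] {p : X} (F : ι → Chain R 1 X)
    (hF : LocFin F) (T : Finset ι) (hT : ∀ i ∉ T, F i ∈ avoiding R 1 p) :
    relClass R p (lfSum F hF) = ∑ i ∈ T, relClass R p (F i) := by
  rw [← map_sum, ← sub_eq_zero, ← map_sub]
  refine relClass_of_mem_avoiding fun σ hσ => ?_
  change coeff R σ (lfSum F hF - ∑ i ∈ T, F i) = 0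
  rw [map_sub, map_sum, coeff_lfSum, sub_eq_zero]
  refine finsum_eq_sum_of_support_subset _ fun i hi => ?_
  by_contra h
  exact hi (hT i h σ hσ)

/-- If `p` is interior to an arc, no other arc meets it. If `p` is a division point, exactly the two
adjacent arcs do, and they concatenate to one arc through `p`. No nonzero period is shorter than two
steps, so such arcs pass `p` only at time `0`. -/
theorem relClass_fundamentalChain (p : M) {δ : ℝ} (hδ : 0 < δ) (hδs : δ < 2 * Φ.step p) :
    relClass R p (Φ.fundamentalChain R) =
      simplexClass R p (seg (Φ.toFun p) (-δ) δ) := by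
  classical
  have hs := Φ.step_pos p
  have key : ∀ a b, a < 0 → 0 < b → -(2 * Φ.step p) < a → b < 2 * Φ.step p →
      simplexClass R p (seg (Φ.toFun p) a b) = simplexClass R p (seg (Φ.toFun p) (-δ) δ) :=
    fun a b ha hb ha' hb' => simplexClass_seg_eq (ε := 2 * Φ.step p)
      (fun t ht h => Φ.eq_zero_of_toFun_eq h ht) ha (neg_lt_zero.2 hδ) hb hδ ha'
      (neg_lt_neg hδs) hb' hδs
  have hedge : ∀ v : M, ∀ u, Φ.toFun v u = p →
      Φ.edge v = seg (Φ.toFun p) (-u) (Φ.step p - u) := by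
    rintro v u rfl
    ext s
    have h : s.1 0 = 1 - s.1 1 := eq_sub_of_add_eq (stdSimplex.add_eq_one s)
    rw [edge, seg_apply, seg_apply, ← Φ.map_add, step_toFun]
    congr 1
    simp only [smul_eq_mul, h]
    ring
  obtain ⟨v, hv, u, hu, hus, hp⟩ := Φ.exists_mem_vertices p
  have hvs : Φ.step v = Φ.step p := by rw [← hp, step_toFun]
  have hothers : ∀ w : Φ.vertices, p ∈ Set.range (Φ.edge w) →
      (w : M) = v ∨ (u = 0 ∧ (w : M) = Φ.toFun p (-Φ.step p)) := by
    intro w hw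
    obtain ⟨u', h0, h1, h2⟩ := Φ.mem_range_edge.1 hw
    have h3 : (w : M) = Φ.toFun v (u - u') := by
      rw [sub_eq_add_neg, Φ.map_add, hp, ← h2, toFun_neg]
    obtain ⟨k, hk⟩ := Φ.exists_of_toFun_mem_vertices hv (h3 ▸ w.2)
    have hws : Φ.step w = Φ.step p := by rw [← h2, step_toFun]
    rw [hws] at h1
    rw [hvs] at hk
    have hk1 : k < 1 := by
      have : (k : ℝ) < 1 := lt_of_mul_lt_mul_right (by linarith) hs.le
      exact_mod_cast this
    have hk2 : -1 ≤ k := by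
      have : (-1 : ℝ) ≤ k := le_of_mul_le_mul_right (by linarith) hs
      exact_mod_cast this
    -- Here `u - u'` is `k` steps, with `u` less than one step and `u'` at most one; `k = -1` forces
    -- `u = 0` and `u'` to be a full step.
    obtain rfl | rfl : k = 0 ∨ k = -1 := by omega
    · left
      rw [h3, hk, Int.cast_zero, zero_mul, Φ.map_zero]
    · right
      push_cast at hk
      have hu0 : u = 0 := by linarith
      refine ⟨hu0, ?_⟩
      have : u' = Φ.step p := by linarith
      rw [← this, ← h2, toFun_neg]
  have havoid : ∀ w : Φ.vertices, p ∉ Set.range (Φ.edge w) →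
      single R (Φ.edge w) ∈ avoiding R 1 p := fun w hw σ hσ =>
    coeff_single_of_ne (by rintro rfl; exact hw hσ)
  rcases hu.eq_or_lt with rfl | hu0
  · rw [Φ.map_zero] at hp
    subst hp
    set w : Φ.vertices := Φ.next.symm ⟨v, hv⟩ with hw
    have hw' : (w : M) = Φ.toFun v (-Φ.step v) := rfl
    have hne : (⟨v, hv⟩ : Φ.vertices) ≠ w := by
      intro h
      have h1 : Φ.toFun v (-Φ.step v) = v := (congrArg Subtype.val h).symm
      have h2 := Φ.eq_zero_of_toFun_eq h1 (by rw [abs_neg, abs_of_pos hs]; linarith)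
      linarith
    rw [fundamentalChain, relClass_lfSum R _ _ {⟨v, hv⟩, w}, Finset.sum_pair hne]
    · change simplexClass R v (Φ.edge v) + simplexClass R v (Φ.edge w) = _
      rw [hedge v 0 (Φ.map_zero v), hedge w (Φ.step v) (by
        rw [hw', ← Φ.map_add, neg_add_cancel, Φ.map_zero]), add_comm, sub_self, neg_zero, sub_zero,
        simplexClass_seg_add]
      exact key _ _ (by linarith) hs (by linarith) (by linarith)
    · intro x hx
      refine havoid x fun h => hx ?_
      rw [Finset.mem_insert, Finset.mem_singleton]
      rcases hothers x h with h1 | h1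
      · exact Or.inl (Subtype.ext h1)
      · exact Or.inr (Subtype.ext (h1.2.trans hw'.symm))
  · rw [fundamentalChain, relClass_lfSum R _ _ {⟨v, hv⟩}, Finset.sum_singleton]
    · change simplexClass R p (Φ.edge v) = _
      rw [hedge v u hp]
      exact key _ _ (by linarith) (by linarith) (by linarith) (by linarith)
    · intro x hx
      refine havoid x fun h => hx ?_
      rw [Finset.mem_singleton]
      rcases hothers x h with h1 | h1
      · exact Subtype.ext h1
      · exact absurd h1.1 hu0.ne'

/-- A space with an étale flow has a fundamental class. -/
theorem exists_isFundamentalClass (R : Type*) [CommRing R] {M : Type*} [TopologicalSpace M]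
    [T1Space M] (Φ : EtaleFlow M) :
    ∃ μ : Homology R 1 M, IsFundamentalClass μ := by
  refine ⟨Homology.mk ⟨Φ.fundamentalChain R, Φ.boundary_fundamentalChain R⟩, fun c hc p z hz => ?_⟩
  obtain ⟨ε, hε, hγ⟩ := Φ.exists_isOpenEmbedding p
  have hs := Φ.step_pos p
  obtain ⟨δ, hδ, hδ'⟩ := exists_between (lt_min hε (show 0 < 2 * Φ.step p by linarith))
  have h1 := relClass_mem_span (R := R) hδ (hδ'.trans_le (min_le_left _ _)) (Φ.map_zero p) hγ hz
  have h2 := Φ.relClass_fundamentalChain R p hδ (hδ'.trans_le (min_le_right _ _))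
  obtain ⟨b, hb⟩ := (Submodule.Quotient.eq _).1 hc
  have h3 : relClass R p (c : Chain R 1 M) = relClass R p (Φ.fundamentalChain R) := by
    rw [← sub_eq_zero, ← map_sub]
    exact (congrArg _ hb.symm).trans (relClass_boundary b)
  rw [← h2, ← h3] at h1
  obtain ⟨r, hr⟩ := Submodule.mem_span_singleton.1 h1
  have h4 : z - r • (c : Chain R 1 M) ∈ relBoundaries R p 1 := by
    rw [← Submodule.Quotient.mk_eq_zero]
    change relClass R p _ = 0
    rw [map_sub, map_smul, hr, sub_self]
  rw [← add_sub_cancel (r • (c : Chain R 1 M)) z]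
  exact add_mem (Submodule.mem_sup_left (Submodule.smul_mem _ _ (Submodule.mem_span_singleton_self _)))
    (Submodule.mem_sup_right h4)

end EtaleFlow

end ClosedSupport

end

/-! ### Global integral curves of bounded vector fields -/

noncomputable section

open Set Metric in
theorem exists_lipschitzOnWith_closedBall {E : Type*} [NormedAddCommGroup E] [NormedSpace ℝ E]
    [ProperSpace E] {X : E → E} (hX : ContDiff ℝ 1 X) (x : E) (r : ℝ) :
    ∃ K, LipschitzOnWith K X (closedBall x r) := by
  obtain ⟨C, hC⟩ := (isCompact_closedBall x r).exists_bound_of_continuousOn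
    (hX.continuous_fderiv one_ne_zero).continuousOn
  refine ⟨C.toNNReal, (convex_closedBall x r).lipschitzOnWith_of_nnnorm_fderiv_le
    (fun y _ => (hX.differentiable one_ne_zero) y) fun y hy => ?_⟩
  rw [← NNReal.coe_le_coe, coe_nnnorm]
  exact (hC y hy).trans (Real.le_coe_toNNReal C)

-- The field is only locally Lipschitz. On a compact subinterval both curves stay in one closed
-- ball, where a Lipschitz constant is available.
open Set Metric in
theorem eqOn_Ioo_of_hasDerivAt {E : Type*} [NormedAddCommGroup E] [NormedSpace ℝ E]
    [ProperSpace E] {X : E → E} (hX : ContDiff ℝ 1 X) {α β : ℝ → E} {a : ℝ}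
    (hα : ∀ t ∈ Ioo (-a) a, HasDerivAt α (X (α t)) t)
    (hβ : ∀ t ∈ Ioo (-a) a, HasDerivAt β (X (β t)) t) (h : α 0 = β 0) :
    EqOn α β (Ioo (-a) a) := by
  intro t ht
  obtain ⟨r, hr, hra⟩ := exists_between (abs_lt.2 ht)
  have hr0 : 0 < r := (abs_nonneg t).trans_lt hr
  have hsub : Icc (-r) r ⊆ Ioo (-a) a := fun s hs =>
    ⟨by linarith [hs.1], by linarith [hs.2]⟩
  have hcα : IsCompact (α '' Icc (-r) r) := isCompact_Icc.image_of_continuousOn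
    fun s hs => (hα s (hsub hs)).continuousAt.continuousWithinAt
  have hcβ : IsCompact (β '' Icc (-r) r) := isCompact_Icc.image_of_continuousOn
    fun s hs => (hβ s (hsub hs)).continuousAt.continuousWithinAt
  obtain ⟨B, hB⟩ := ((hcα.union hcβ).isBounded).subset_closedBall 0
  obtain ⟨K, hK⟩ := exists_lipschitzOnWith_closedBall hX 0 B
  exact ODE_solution_unique_of_mem_Ioo (v := fun _ => X) (s := fun _ => closedBall 0 B)
    (t₀ := 0) (fun _ _ => hK) ⟨neg_lt_zero.2 hr0, hr0⟩
    (fun s hs => ⟨hα s (hsub (Ioo_subset_Icc_self hs)),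
      hB (Or.inl ⟨s, Ioo_subset_Icc_self hs, rfl⟩)⟩)
    (fun s hs => ⟨hβ s (hsub (Ioo_subset_Icc_self hs)),
      hB (Or.inr ⟨s, Ioo_subset_Icc_self hs, rfl⟩)⟩) h (abs_lt.1 hr)

/-- A bounded continuously differentiable vector field has global integral curves. -/
theorem exists_forall_hasDerivAt {E : Type*} [NormedAddCommGroup E] [NormedSpace ℝ E]
    [ProperSpace E] {X : E → E} (hX : ContDiff ℝ 1 X) {C : NNReal} (hC : ∀ x, ‖X x‖ ≤ C) (x : E) :
    ∃ γ : ℝ → E, γ 0 = x ∧ ∀ t, HasDerivAt γ (X (γ t)) t := by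
  have hloc : ∀ a : ℝ, ∃ α : ℝ → E, α 0 = x ∧
      ∀ t ∈ Set.Ioo (-a) a, HasDerivAt α (X (α t)) t := by
    intro a
    rcases le_or_gt a 0 with ha | ha
    · exact ⟨fun _ => x, rfl, fun t ht => by linarith [ht.1, ht.2]⟩
    · have h0 : (0 : ℝ) ∈ Set.Icc (-a) a := ⟨by linarith, ha.le⟩
      -- With speed at most `C`, a solution cannot leave the ball of radius `C * a` within time `a`,
      -- so Picard–Lindelöf applies on the whole interval.
      obtain ⟨K, hK⟩ := exists_lipschitzOnWith_closedBall hX x (C * a.toNNReal : NNReal)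
      have hPL : IsPicardLindelof (fun _ => X) (⟨0, h0⟩ : Set.Icc (-a) a) x
          (C * a.toNNReal) 0 C K := .of_time_independent (fun y _ => hC y) hK (by
        simp [Real.coe_toNNReal a ha.le])
      obtain ⟨α, h1, h2⟩ := hPL.exists_eq_forall_mem_Icc_hasDerivWithinAt₀
      exact ⟨α, h1, fun t ht => (h2 t (Set.Ioo_subset_Icc_self ht)).hasDerivAt
        (Icc_mem_nhds ht.1 ht.2)⟩
  choose α h0 hα using hloc
  -- By uniqueness the local solutions agree, so the one on a radius slightly larger than `|t|`
  -- defines the global curve at `t`.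
  have hγ : ∀ a t, |t| < a → α (|t| + 1) t = α a t := by
    intro a t ht
    refine eqOn_Ioo_of_hasDerivAt hX (a := min (|t| + 1) a) (fun s hs => hα _ s ?_)
      (fun s hs => hα _ s ?_) ((h0 _).trans (h0 _).symm) (abs_lt.1 (lt_min (by linarith) ht))
    · exact abs_lt.1 ((abs_lt.2 hs).trans_le (min_le_left _ _))
    · exact abs_lt.1 ((abs_lt.2 hs).trans_le (min_le_right _ _))
  refine ⟨fun t => α (|t| + 1) t, h0 _, fun t => ?_⟩
  have h1 := hα (|t| + 1) t (abs_lt.1 (by linarith))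
  refine h1.congr_of_eventuallyEq ?_
  filter_upwards [(isOpen_lt continuous_abs continuous_const).mem_nhds
    (show |t| < |t| + 1 by linarith)] with s hs
  exact hγ _ s hs

theorem eq_of_forall_hasDerivAt {E : Type*} [NormedAddCommGroup E] [NormedSpace ℝ E]
    [ProperSpace E] {X : E → E} (hX : ContDiff ℝ 1 X) {α β : ℝ → E}
    (hα : ∀ t, HasDerivAt α (X (α t)) t) (hβ : ∀ t, HasDerivAt β (X (β t)) t) (h : α 0 = β 0) :
    α = β := by
  funext t
  exact eqOn_Ioo_of_hasDerivAt hX (a := |t| + 1) (fun s _ => hα s) (fun s _ => hβ s) h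
    (abs_lt.1 (by linarith))

/-! ### The tangent field of the curve and its flow -/

section

open MvPolynomial

theorem MvPolynomial.hasDerivAt_eval {ι : Type*} [Fintype ι] (f : MvPolynomial ι ℝ)
    {c : ℝ → ι → ℝ} {c' : ι → ℝ} {t : ℝ} (hc : ∀ i, HasDerivAt (fun s => c s i) (c' i) t) :
    HasDerivAt (fun s => eval (c s) f) (∑ i, eval (c t) (pderiv i f) * c' i) t := by
  classical
  induction f using MvPolynomial.induction_on with
  | C a => simpa using hasDerivAt_const t a
  | add p q hp hq =>
    simp only [map_add, add_mul, Finset.sum_add_distrib]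
    exact hp.add hq
  | mul_X p n hp =>
    simp only [map_mul, eval_X]
    convert! hp.mul (hc n) using 1
    simp only [Derivation.leibniz, pderiv_X, smul_eq_mul, map_add, map_mul, eval_X, add_mul,
      Finset.sum_add_distrib, Finset.sum_mul]
    rw [add_comm]
    congr 1
    · exact Finset.sum_congr rfl fun i _ => by ring
    · rw [Finset.sum_eq_single n]
      · simp
      · intro i _ hi
        simp [Pi.single_eq_of_ne' hi]
      · simp

theorem MvPolynomial.contDiff_eval {ι : Type*} [Fintype ι] (f : MvPolynomial ι ℝ) {n : ℕ∞} :
    ContDiff ℝ n fun z : ι → ℝ => eval z f :=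
  (AnalyticOnNhd.eval_mvPolynomial f).contDiff

/-- The derivatives of `f` in logarithmic coordinates, rotated by a right angle. -/
def logRotGrad (f : MvPolynomial (Fin 2) ℝ) : Fin 2 → MvPolynomial (Fin 2) ℝ :=
  ![X 1 * pderiv 1 f, -(X 0 * pderiv 0 f)]

/-- A normalizing factor for the vector field with the components `z i * logRotGrad f i`. -/
def normalizer (f : MvPolynomial (Fin 2) ℝ) (z : Fin 2 → ℝ) : ℝ :=
  1 + ∑ i, (eval z (logRotGrad f i) ^ 2 + (z i * eval z (logRotGrad f i)) ^ 2)

/-- A bounded vector field tangent to the curve. -/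
def tangentField (f : MvPolynomial (Fin 2) ℝ) (z : Fin 2 → ℝ) : Fin 2 → ℝ := fun i =>
  eval z (logRotGrad f i) / normalizer f z * z i

section tangentField

variable (f : MvPolynomial (Fin 2) ℝ)

theorem normalizer_pos (z : Fin 2 → ℝ) : 0 < normalizer f z := by
  unfold normalizer
  positivity

theorem le_normalizer (z : Fin 2 → ℝ) (i : Fin 2) : 1 + (eval z (logRotGrad f i) ^ 2 +
    (z i * eval z (logRotGrad f i)) ^ 2) ≤ normalizer f z := by
  have h := Finset.single_le_sum (f := fun i => eval z (logRotGrad f i) ^ 2 +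
    (z i * eval z (logRotGrad f i)) ^ 2) (fun i _ => by positivity) (Finset.mem_univ i)
  unfold normalizer
  linarith

theorem contDiff_tangentField : ContDiff ℝ 1 (tangentField f) := by
  have h : ∀ i, ContDiff ℝ 1 fun z => eval z (logRotGrad f i) := fun i =>
    contDiff_eval _ (n := 1)
  refine contDiff_pi.2 fun i => ?_
  refine ((h i).div ?_ fun z => (normalizer_pos f z).ne').mul (contDiff_apply _ _ i)
  exact contDiff_const.add (ContDiff.sum fun j _ =>
    ((h j).pow 2).add (((contDiff_apply _ _ j).mul (h j)).pow 2))

/-- From `|w| ≤ 1 + w ^ 2`. This bounds the growth rate of each coordinate along the flow. -/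
theorem abs_div_normalizer_le (z : Fin 2 → ℝ) (i : Fin 2) :
    |eval z (logRotGrad f i) / normalizer f z| ≤ 1 := by
  rw [abs_div, abs_of_pos (normalizer_pos f z), div_le_one (normalizer_pos f z)]
  refine le_trans ?_ (le_normalizer f z i)
  rw [abs_le]
  constructor <;> nlinarith [sq_nonneg (eval z (logRotGrad f i) + 1),
    sq_nonneg (eval z (logRotGrad f i) - 1), sq_nonneg (z i * eval z (logRotGrad f i))]

theorem norm_tangentField_le (z : Fin 2 → ℝ) : ‖tangentField f z‖ ≤ (1 : NNReal) := by
  rw [NNReal.coe_one, pi_norm_le_iff_of_nonneg zero_le_one]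
  intro i
  rw [tangentField, Real.norm_eq_abs, div_mul_eq_mul_div, abs_div,
    abs_of_pos (normalizer_pos f z), div_le_one (normalizer_pos f z)]
  refine le_trans ?_ (le_normalizer f z i)
  set w := eval z (logRotGrad f i)
  rw [abs_le]
  constructor <;> nlinarith [sq_nonneg (z i * w + 1), sq_nonneg (z i * w - 1), sq_nonneg w]

theorem sum_pderiv_mul_tangentField (z : Fin 2 → ℝ) :
    ∑ i, eval z (pderiv i f) * tangentField f z i = 0 := by
  simp only [Fin.sum_univ_two, tangentField, logRotGrad, Matrix.cons_val_zero, Matrix.cons_val_one,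
    map_mul, map_neg, eval_X]
  ring

variable {f}

/-- Each coordinate solves a scalar linear equation with bounded coefficient, so if it vanished once
it would vanish always. The field is orthogonal to the gradient, so `f` is constant along `γ`. -/
theorem mem_realCurve_of_hasDerivAt {γ : ℝ → Fin 2 → ℝ}
    (hγ : ∀ t, HasDerivAt γ (tangentField f (γ t)) t) (h0 : γ 0 ∈ realCurve f) (t : ℝ) :
    γ t ∈ realCurve f := by
  have hγ' : ∀ i t, HasDerivAt (fun s => γ s i) (tangentField f (γ t) i) t := fun i t =>
    hasDerivAt_pi.1 (hγ t) i
  constructor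
  · intro i hi
    have h1 : (fun s => γ s i) = fun _ => 0 := by
      refine ODE_solution_unique_univ
        (v := fun s y => eval (γ s) (logRotGrad f i) / normalizer f (γ s) * y) (K := 1)
        (s := fun _ => Set.univ) (t₀ := t) (fun s => ?_) (fun s => ⟨hγ' i s, trivial⟩)
        (fun s => ⟨?_, trivial⟩) hi
      · refine LipschitzOnWith.of_dist_le_mul fun y _ w _ => ?_
        rw [Real.dist_eq, Real.dist_eq, ← mul_sub, abs_mul, NNReal.coe_one]
        exact mul_le_mul_of_nonneg_right (abs_div_normalizer_le f _ i) (abs_nonneg _)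
      · rw [mul_zero]
        exact hasDerivAt_const s 0
    exact h0.1 i (congrFun h1 0)
  · have h1 : ∀ s, HasDerivAt (fun s => eval (γ s) f) 0 s := by
      intro s
      have h2 := hasDerivAt_eval f fun i => hγ' i s
      rwa [sum_pderiv_mul_tangentField] at h2
    rw [is_const_of_deriv_eq_zero (fun s => (h1 s).differentiableAt) (fun s => (h1 s).deriv) t 0]
    exact h0.2

/-- On a convex set where one partial derivative has no zeros, points of the curve are determined by
the other coordinate. -/
theorem eq_of_eval_eq_zero {B : Set (Fin 2 → ℝ)} (hB : Convex ℝ B) {j : Fin 2}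
    (hj : ∀ z ∈ B, eval z (pderiv j f) ≠ 0) {y w : Fin 2 → ℝ} (hy : y ∈ B) (hw : w ∈ B)
    (hyf : eval y f = 0) (hwf : eval w f = 0) (h : ∀ i ≠ j, y i = w i) : y = w := by
  have hd : ∀ s : ℝ, HasDerivAt (fun s : ℝ => eval (y + s • (w - y)) f)
      (eval (y + s • (w - y)) (pderiv j f) * (w j - y j)) s := by
    intro s
    have h1 := hasDerivAt_eval f (c := fun s : ℝ => y + s • (w - y)) (c' := w - y) (t := s)
      fun i => by
        simpa using ((hasDerivAt_id s).mul_const (w i - y i)).const_add (y i)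
    rwa [Finset.sum_eq_single j (fun i _ hi => by rw [Pi.sub_apply, h i hi, sub_self, mul_zero])
      (by simp)] at h1
  -- Rolle on the segment from `y` to `w`, along which only coordinate `j` varies.
  obtain ⟨s, hs, h0⟩ := exists_hasDerivAt_eq_zero (a := 0) (b := 1) zero_lt_one
    (fun s _ => (hd s).continuousAt.continuousWithinAt)
    (show eval (y + (0 : ℝ) • (w - y)) f = eval (y + (1 : ℝ) • (w - y)) f by simp [hyf, hwf])
    fun s _ => hd s
  have hsB := hB.add_smul_sub_mem hy hw ⟨hs.1.le, hs.2.le⟩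
  funext i
  by_cases hi : i = j
  · rw [hi]
    exact (sub_eq_zero.1 ((mul_eq_zero.1 h0).resolve_left (hj _ hsB))).symm
  · exact h i hi

/-- Component `i` of the field is, up to sign and a nonzero factor, the partial derivative in the
other variable `j`. Hence `i` is a local parameter both of the curve and of the orbit. -/
theorem exists_tangentField_ne_zero (hf : IsNonsingularCurve f) {z : Fin 2 → ℝ}
    (hz : z ∈ realCurve f) : ∃ i j : Fin 2, (∀ k ≠ j, k = i) ∧ eval z (pderiv j f) ≠ 0 ∧
      tangentField f z i ≠ 0 := by
  obtain ⟨j, hj⟩ := hf z hz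
  have hN := (normalizer_pos f z).ne'
  have h0 := hz.1 0
  have h1 := hz.1 1
  fin_cases j
  · refine ⟨1, 0, by decide, hj, mul_ne_zero (div_ne_zero ?_ hN) h1⟩
    simpa [logRotGrad] using ⟨h0, hj⟩
  · refine ⟨0, 1, by decide, hj, mul_ne_zero (div_ne_zero ?_ hN) h0⟩
    simpa [logRotGrad] using ⟨h1, hj⟩

/-- The flow of the tangent field on a non-singular curve. -/
theorem exists_etaleFlow (hf : IsNonsingularCurve f) :
    Nonempty (ClosedSupport.EtaleFlow (realCurve f)) := by
  have hX := contDiff_tangentField f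
  choose γ h0 hγ using exists_forall_hasDerivAt hX (norm_tangentField_le f)
  have hmem : ∀ (x : realCurve f) t, γ x t ∈ realCurve f := fun x t =>
    mem_realCurve_of_hasDerivAt (hγ x) (by rw [h0]; exact x.2) t
  have hcont : ∀ x, Continuous (γ x) := fun x =>
    continuous_iff_continuousAt.2 fun t => (hγ x t).continuousAt
  have hstrict : ∀ x i, HasStrictDerivAt (fun t => γ x t i) (tangentField f x i) 0 := by
    intro x i
    have h := hasStrictDerivAt_of_hasDerivAt_of_continuousAt (f := fun t => γ x t i)
      (f' := fun t => tangentField f (γ x t) i) (x := 0)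
      (Filter.Eventually.of_forall fun t => hasDerivAt_pi.1 (hγ x t) i)
      (((continuous_apply i).comp (hX.continuous.comp (hcont x))).continuousAt)
    rwa [h0] at h
  refine ⟨⟨fun x => ⟨fun t => ⟨γ x t, hmem x t⟩, (hcont x).subtype_mk _⟩, fun x =>
    Subtype.ext (h0 x), fun x s t => Subtype.ext ?_, fun x ε hε => ?_, fun x => ?_⟩⟩
  · have h1 : (fun t => γ x (s + t)) = γ (γ x s) :=
      eq_of_forall_hasDerivAt hX (fun t => (hγ x (s + t)).comp_const_add s t) (hγ _)
        (by rw [h0, add_zero])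
    exact congrFun h1 t
  · obtain ⟨i, j, hij, hj, hi⟩ := exists_tangentField_ne_zero hf x.2
    obtain ⟨r, hr, hB⟩ := Metric.isOpen_iff.1 (isOpen_ne_fun
      (MvPolynomial.continuous_eval (pderiv j f)) continuous_const) (x : Fin 2 → ℝ) hj
    have hS : {t | t ∈ Set.Ioo (-ε) ε ∧ γ x t ∈ Metric.ball (x : Fin 2 → ℝ) r} ∈ nhds (0 : ℝ) := by
      refine Filter.inter_mem (Ioo_mem_nhds (by linarith) hε) ?_
      have h1 : Metric.ball (x : Fin 2 → ℝ) r ∈ nhds (γ x 0) := by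
        rw [h0]
        exact Metric.ball_mem_nhds _ hr
      exact (hcont x).continuousAt.preimage_mem_nhds h1
    -- Coordinate `i` moves with nonzero speed, so its values at short times fill a neighbourhood of
    -- `x i`. A curve point near `x` then shares this coordinate with an orbit point in the same
    -- ball, and there the two must coincide.
    have hS' := Filter.image_mem_map (m := fun t => γ x t i) hS
    rw [(hstrict x i).map_nhds_eq hi, h0] at hS'
    have hc : Continuous fun y : realCurve f => (y : Fin 2 → ℝ) i :=
      (continuous_apply i).comp continuous_subtype_val
    filter_upwards [hc.continuousAt.preimage_mem_nhds hS',
      continuous_subtype_val.continuousAt.preimage_mem_nhds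
        (Metric.ball_mem_nhds (x : Fin 2 → ℝ) hr)] with y hy hyB
    obtain ⟨t, ⟨ht, htB⟩, hty⟩ := hy
    refine ⟨t, ht, Subtype.ext ?_⟩
    refine eq_of_eval_eq_zero (convex_ball (x : Fin 2 → ℝ) r) (fun z hz => hB hz) htB hyB
      (hmem x t).2 y.2.2 fun k hk => ?_
    rw [hij k hk]
    exact hty
  · obtain ⟨i, j, hij, hj, hi⟩ := exists_tangentField_ne_zero hf x.2
    obtain ⟨ε, hε, h⟩ := Metric.eventually_nhds_iff_ball.1
      ((hstrict x i).eventually_left_inverse hi)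
    rw [Real.ball_eq_Ioo, zero_sub, zero_add] at h
    refine ⟨ε, hε, fun s hs t ht hst => ?_⟩
    rw [← h s hs, ← h t ht]
    exact congrArg _ (congrFun (congrArg Subtype.val hst) i)

end tangentField

end

end

theorem mainTheorem7 (R : Type*) [CommRing R] (f : MvPolynomial (Fin 2) ℝ) (hf : f ≠ 0) :
    (IsNonsingularCurve f →
      ∃ μ : ClosedSupport.Homology R 1 (realCurve f), ClosedSupport.IsFundamentalClass μ) ∧
    (∀ μ : ClosedSupport.Homology R 1 (realCurve f),
      ClosedSupport.homologyMap R 1 (logCurve f) (isProperMap_logCurve f) μ = 0) ∧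
    (∀ c ∈ ClosedSupport.cycles R 1 (realCurve f),
      ∃ b : ClosedSupport.Chain R 2 (Fin 2 → ℝ),
        ClosedSupport.boundary R 1 (Fin 2 → ℝ) b =
          ClosedSupport.chainMap R 1 (logCurve f) (isProperMap_logCurve f) c) := by
  have hbound : ∀ c ∈ ClosedSupport.cycles R 1 (realCurve f),
      ∃ b : ClosedSupport.Chain R 2 (Fin 2 → ℝ),
        ClosedSupport.boundary R 1 (Fin 2 → ℝ) b =
          ClosedSupport.chainMap R 1 (logCurve f) (isProperMap_logCurve f) c := fun c hc =>
    ClosedSupport.exists_boundary_plane (ClosedSupport.chainMap_mem_cycles R 1 _ _ c hc)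
  refine ⟨fun h => (exists_etaleFlow h).elim fun Φ => Φ.exists_isFundamentalClass R, ?_, hbound⟩
  intro μ
  obtain ⟨c, rfl⟩ := Submodule.Quotient.mk_surjective _ μ
  exact (Submodule.Quotient.mk_eq_zero _).2 (hbound c c.2)
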